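/- Let $M=\mathrm{SL}_2\mathbb R\times\mathrm{SL}_2\mathbb R\subset\mathbb R^{2\times2}\times\mathbb R^{2\times2}$, with tangent spaces $T_{(A,B)}M=\{(A\alpha,B\beta):\alpha,\beta\in\mathfrak{sl}_2\mathbb R\}$. Put $$J(A\alpha,B\beta)=\tfrac1{\sqrt3}\bigl(A(\alpha-2\beta),B(2\alpha-\beta)\bigr),\qquad P(A\alpha,B\beta)=(A\beta,B\alpha),$$ and let $g(Z,W)=\frac14\bigl(\langle Z,W\rangle+\langle JZ,JW\rangle\bigr)$ be the nearly Kähler metric, where $\langle\cdot,\cdot\rangle$ is the product of two copies of the metric induced on $\mathrm{SL}_2\mathbb R$ by the bilinear form $-\frac12(x_1y_4-x_2y_3-x_3y_2+x_4y_1)$ on matrices $\begin{pmatrix}x_1&x_2\\x_3&x_4\end{pmatrix}$. Let $\nabla$ be the Levi-Civita connection of $g$. Let $\Sigma$ be a connected smooth surface and consider smooth immersions $F:\Sigma\to M$ that are almost complex (each tangent plane $dF(T_p\Sigma)$ is $J$-invariant), degenerate ($g$ vanishes identically on each tangent plane), and such that $P$ preserves no tangent plane. Near each point of $\Sigma$ there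 is a smooth tangent vector field $X$, unique up to sign at each point, with $g(X,PX)=1$ and $g(X,JPX)=0$. The following hold. (i) There is a constant angle $\varphi$ such that, for each such local field $X$, $$g(\nabla_XX,(\nabla_XJ)PX)=\tfrac23\cos\varphi,\qquad g(\nabla_XX,J(\nabla_XJ)PX)=\tfrac23\sin\varphi .$$ (ii) If two such immersions $F,G:\Sigma\to M$ have the same constant angle $\varphi$ (modulo $2\pi$), then they locally coincide up to isometry: for all $p,q\in\Sigma$ there are an isometry $\Phi$ of $(M,g)$ and a diffeomorphism $\sigma$ from a neighbourhood of $p$ onto a neighbourhood of $q$ with $\sigma(p)=q$ and $\Phi\circ F=G\circ\sigma$ near $p$. -/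

import Mathlib

open scoped Manifold ContDiff Topology

noncomputable section

namespace NKSL2

/-- The algebra `ℝ^{2×2}` of real `2 × 2` matrices. -/
def Mat : Type := Matrix (Fin 2) (Fin 2) ℝ

/-- A norm on `ℝ^{2×2}`; it serves only to differentiate. -/
instance : NormedRing Mat := Matrix.linftyOpNormedRing (n := Fin 2) (α := ℝ)

instance : NormedAlgebra ℝ Mat := Matrix.linftyOpNormedAlgebra (n := Fin 2) (α := ℝ)

instance : FiniteDimensional ℝ Mat :=
  inferInstanceAs (FiniteDimensional ℝ (Matrix (Fin 2) (Fin 2) ℝ))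

instance : Inv Mat := ⟨fun A => (Inv.inv (A : Matrix (Fin 2) (Fin 2) ℝ) : Matrix (Fin 2) (Fin 2) ℝ)⟩

/-- The determinant. -/
def Mat.det (A : Mat) : ℝ := Matrix.det (A : Matrix (Fin 2) (Fin 2) ℝ)

/-- The trace. -/
def Mat.trace (A : Mat) : ℝ := Matrix.trace (A : Matrix (Fin 2) (Fin 2) ℝ)

lemma Mat.ext {A B : Mat} (h : ∀ i j, A i j = B i j) : A = B := Matrix.ext h

lemma Mat.mul_apply (A B : Mat) (i j : Fin 2) : (A * B) i j = A i 0 * B 0 j + A i 1 * B 1 j := by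
  refine (Matrix.mul_apply (M := (A : Matrix (Fin 2) (Fin 2) ℝ)) (N := B)).trans ?_
  rw [Fin.sum_univ_two]

lemma Mat.add_apply (A B : Mat) (i j : Fin 2) : (A + B) i j = A i j + B i j := rfl

lemma Mat.sub_apply (A B : Mat) (i j : Fin 2) : (A - B) i j = A i j - B i j := rfl

lemma Mat.smul_apply (c : ℝ) (A : Mat) (i j : Fin 2) : (c • A) i j = c * A i j := rfl

lemma Mat.inv_mul {A : Mat} (hA : A.det = 1) : A⁻¹ * A = 1 :=
  Matrix.nonsing_inv_mul (A : Matrix (Fin 2) (Fin 2) ℝ) (by change IsUnit A.det; simp [hA])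

lemma Mat.mul_inv {A : Mat} (hA : A.det = 1) : A * A⁻¹ = 1 :=
  Matrix.mul_nonsing_inv (A : Matrix (Fin 2) (Fin 2) ℝ) (by change IsUnit A.det; simp [hA])

/-- The ambient vector space `ℝ^{2×2} × ℝ^{2×2}`. -/
abbrev E : Type := Mat × Mat

/-- `SL₂ℝ × SL₂ℝ`, as a submanifold of `ℝ^{2×2} × ℝ^{2×2}`. -/
def SL2SL2 : Set E := {a | a.1.det = 1 ∧ a.2.det = 1}

/-- `(α, β) ↦ (Aα, Bβ)` for `a = (A, B)`. -/
def leftMul (a : E) : E →ₗ[ℝ] E where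
  toFun z := (a.1 * z.1, a.2 * z.2)
  map_add' x y := by ext1 <;> simp [mul_add]
  map_smul' c x := by ext1 <;> simp

/-- `(U, V) ↦ (A⁻¹U, B⁻¹V)` for `a = (A, B)`: the left trivialisation of tangent vectors. -/
def leftTriv (a : E) : E →ₗ[ℝ] E where
  toFun z := (a.1⁻¹ * z.1, a.2⁻¹ * z.2)
  map_add' x y := by ext1 <;> simp [mul_add]
  map_smul' c x := by ext1 <;> simp

/-- `T_{(A,B)}(SL₂ℝ × SL₂ℝ) = {(Aα, Bβ) | α, β traceless}`. -/
def tangentSL (a : E) : Set E :=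
  {Z | ∃ α β : Mat, α.trace = 0 ∧ β.trace = 0 ∧ Z = (a.1 * α, a.2 * β)}

/-- The almost complex structure on pairs `(α, β)` of the Lie algebra. -/
def jAlg : E →ₗ[ℝ] E where
  toFun z := (1 / √3 : ℝ) • (z.1 - (2 : ℝ) • z.2, (2 : ℝ) • z.1 - z.2)
  map_add' x y := by ext1 <;> simp <;> module
  map_smul' c x := by ext1 <;> simp <;> module

/-- The almost product structure on pairs `(α, β)` of the Lie algebra. -/
def pAlg : E →ₗ[ℝ] E where
  toFun z := (z.2, z.1)
  map_add' _ _ := rfl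
  map_smul' _ _ := rfl

/-- The almost complex structure `J(Aα, Bβ) = (1/√3) (A(α - 2β), B(2α - β))`. -/
def J (a : E) : E →ₗ[ℝ] E := leftMul a ∘ₗ jAlg ∘ₗ leftTriv a

/-- The almost product structure `P(Aα, Bβ) = (Aβ, Bα)`. -/
def P (a : E) : E →ₗ[ℝ] E := leftMul a ∘ₗ pAlg ∘ₗ leftTriv a

/-- The inner product `-(1/2) (x₁y₄ - x₂y₃ - x₃y₂ + x₄y₁)` on `ℝ^{2×2}`. -/
def inner4 (x y : Mat) : ℝ :=
  -(1 / 2) * (x 0 0 * y 1 1 - x 0 1 * y 1 0 - x 1 0 * y 0 1 + x 1 1 * y 0 0)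

/-- The product metric. -/
def prodMetric (Z W : E) : ℝ := inner4 Z.1 W.1 + inner4 Z.2 W.2

/-- The nearly Kähler metric `g(Z, W) = (1/4) (⟨Z, W⟩ + ⟨JZ, JW⟩)` at the point `a`. -/
def g (a Z W : E) : ℝ := 1 / 4 * (prodMetric Z W + prodMetric (J a Z) (J a W))

/-- The Levi-Civita connection of `g` on left invariant vector fields:
`∇_{aξ} (aη) = a Γ(ξ, η)`, where
`2 g(Γ(ξ, η), ζ) = g([ξ, η], ζ) - g([η, ζ], ξ) + g([ζ, ξ], η)` (Koszul formula). -/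
def Γ (ξ η : E) : E :=
  (1 / 2 : ℝ) • (ξ * η - η * ξ) +
    (1 / 6 : ℝ) • (((ξ.2 * η.1 - η.1 * ξ.2) - (ξ.1 * η.2 - η.2 * ξ.1),
      (ξ.1 * η.2 - η.2 * ξ.1) - (ξ.2 * η.1 - η.1 * ξ.2)) : E)

/-! The metric `g` is left invariant, and the next facts say that `Γ` is its Levi-Civita connection
on left invariant vector fields. -/

lemma leftTriv_leftMul {a : E} (ha : a ∈ SL2SL2) (z : E) : leftTriv a (leftMul a z) = z := by
  obtain ⟨h1, h2⟩ := ha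
  ext1 <;> simp [leftTriv, leftMul, ← mul_assoc, Mat.inv_mul, h1, h2]

lemma leftMul_leftTriv {a : E} (ha : a ∈ SL2SL2) (z : E) : leftMul a (leftTriv a z) = z := by
  obtain ⟨h1, h2⟩ := ha
  ext1 <;> simp [leftTriv, leftMul, ← mul_assoc, Mat.mul_inv, h1, h2]

lemma inner4_mul {A : Mat} (hA : A.det = 1)
    (x y : Mat) : inner4 (A * x) (A * y) = inner4 x y := by
  have hA' : A 0 0 * A 1 1 - A 0 1 * A 1 0 = 1 := by
    rw [← hA]; exact (Matrix.det_fin_two A).symm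
  simp only [inner4, Mat.mul_apply]
  linear_combination (-(1 / 2) * (x 0 0 * y 1 1 - x 0 1 * y 1 0 - x 1 0 * y 0 1 + x 1 1 * y 0 0))
    * hA'

/-- `g` on pairs of the Lie algebra. -/
def gAlg (ξ η : E) : ℝ := 1 / 4 * (prodMetric ξ η + prodMetric (jAlg ξ) (jAlg η))

/-- `g` is left invariant. -/
lemma g_leftMul {a : E} (ha : a ∈ SL2SL2) (ξ η : E) :
    g a (leftMul a ξ) (leftMul a η) = gAlg ξ η := by
  have h : ∀ ξ η : E, prodMetric (leftMul a ξ) (leftMul a η) = prodMetric ξ η := fun ξ η => by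
    simp [prodMetric, leftMul, inner4_mul ha.1, inner4_mul ha.2]
  simp [g, gAlg, J, leftTriv_leftMul ha, h]

/-- `Γ` is torsion free. -/
lemma Γ_torsion (ξ η : E) : Γ ξ η - Γ η ξ = ξ * η - η * ξ := by
  ext1 <;> simp [Γ] <;> module

lemma gAlg_eq (ξ η : E) :
    gAlg ξ η = 2 / 3 * prodMetric ξ η - 1 / 3 * prodMetric (pAlg ξ) η := by
  have h : (√3)⁻¹ * (√3)⁻¹ = (1 / 3 : ℝ) := by
    rw [← mul_inv, Real.mul_self_sqrt (by norm_num)]; norm_num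
  simp only [gAlg, prodMetric, inner4, jAlg, pAlg, LinearMap.coe_mk, AddHom.coe_mk, Prod.smul_fst,
    Prod.smul_snd, Mat.smul_apply, Mat.sub_apply, one_div]
  ring_nf
  have h' : (√3)⁻¹ ^ 2 = (1 / 3 : ℝ) := by rw [sq, h]
  rw [h']
  ring

/-- `Γ` is metric. -/
lemma Γ_metric (ξ η ζ : E) : gAlg (Γ ξ η) ζ + gAlg η (Γ ξ ζ) = 0 := by
  simp only [gAlg_eq, prodMetric, inner4, pAlg, Γ, LinearMap.coe_mk, AddHom.coe_mk, Prod.smul_fst,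
    Prod.smul_snd, Prod.fst_add, Prod.snd_add, Prod.fst_sub, Prod.snd_sub, Prod.fst_mul,
    Prod.snd_mul, Mat.add_apply,
    Mat.smul_apply, Mat.sub_apply, Mat.mul_apply]
  ring

/-! ### Surfaces

Below, `S` is a surface: a smooth manifold modelled on the plane. -/

section Surface

variable {S : Type*} [TopologicalSpace S] [ChartedSpace (EuclideanSpace ℝ (Fin 2)) S]

/-- The differential at `x` of a map `Z` from the surface to `ℝ^{2×2} × ℝ^{2×2}`. -/
def dE (Z : S → E) (x : S) : TangentSpace (𝓡 2) x →L[ℝ] E := mfderiv (𝓡 2) 𝓘(ℝ, E) Z x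

/-- The covariant derivative `∇_v Z` with respect to the Levi-Civita connection of `g`, for a
vector field `Z` along a map `F : S → SL₂ℝ × SL₂ℝ` and a tangent vector `v` of `S` at `x`.
With the left trivialisations `Z = F ζ` and `dF(v) = F(x) ξ` it is `F(x) (dζ(v) + Γ(ξ, ζ(x)))`. -/
def nabla (F : S → E) (x : S) (v : TangentSpace (𝓡 2) x) (Z : S → E) : E :=
  leftMul (F x) (dE (fun y => leftTriv (F y) (Z y)) x v +
    Γ (leftTriv (F x) (dE F x v)) (leftTriv (F x) (Z x)))

/-- `(∇_v J) Z = ∇_v (J Z) - J ∇_v Z`, for a vector field `Z` along `F`. -/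
def nablaJ (F : S → E) (x : S) (v : TangentSpace (𝓡 2) x) (Z : S → E) : E :=
  nabla F x v (fun y => J (F y) (Z y)) - J (F x) (nabla F x v Z)

/-- The tangent plane `dF(T_x S)` of an immersed surface. -/
def tangentPlane (F : S → E) (x : S) : Submodule ℝ E := (dE F x).range

/-- `F` is a smooth immersion into `SL₂ℝ × SL₂ℝ`, the tangent planes are `J`-invariant, and `g`
vanishes on them. -/
structure IsDegenerateAlmostComplex (F : S → E) : Prop where
  mem : ∀ x, F x ∈ SL2SL2
  smooth : ContMDiff (𝓡 2) 𝓘(ℝ, E) ∞ F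
  immersion : ∀ x, Function.Injective (dE F x)
  almostComplex : ∀ x, (tangentPlane F x).map (J (F x)) = tangentPlane F x
  degenerate : ∀ x, ∀ u ∈ tangentPlane F x, ∀ v ∈ tangentPlane F x, g (F x) u v = 0

/-- At no point does `P` preserve the tangent plane. -/
def PNotPreserving (F : S → E) : Prop :=
  ∀ x, (tangentPlane F x).map (P (F x)) ≠ tangentPlane F x

/-- `g(v, Pv) = 1` and `g(v, JPv) = 0` for a tangent vector `v` of the surface at `x`. -/
def IsNormalized (F : S → E) (x : S) (v : TangentSpace (𝓡 2) x) : Prop :=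
  g (F x) (dE F x v) (P (F x) (dE F x v)) = 1 ∧
    g (F x) (dE F x v) (J (F x) (P (F x) (dE F x v))) = 0

/-- `X` is a smooth vector field on the open set `U` of the surface with `g(X, PX) = 1` and
`g(X, JPX) = 0`. -/
structure IsAdaptedField [IsManifold (𝓡 2) ∞ S] (F : S → E) (U : Set S)
    (X : (x : S) → TangentSpace (𝓡 2) x) : Prop where
  isOpen : IsOpen U
  smooth : ContMDiffOn (𝓡 2) (𝓡 2).tangent ∞ (fun x => (⟨x, X x⟩ : TangentBundle (𝓡 2) S)) U
  normalized : ∀ x ∈ U, IsNormalized F x (X x)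

/-- The vector `∇_X X` at `x`, tangent to `SL₂ℝ × SL₂ℝ`. -/
def nablaXX (F : S → E) (X : (x : S) → TangentSpace (𝓡 2) x) (x : S) : E :=
  nabla F x (X x) (fun y => dE F y (X y))

/-- The vector `(∇_X J)PX` at `x`, tangent to `SL₂ℝ × SL₂ℝ`. -/
def nablaJPX (F : S → E) (X : (x : S) → TangentSpace (𝓡 2) x) (x : S) : E :=
  nablaJ F x (X x) (fun y => P (F y) (dE F y (X y)))

/-- The constant `φ` is an angle function of the surface: for each locally defined field `X` as
above, `(2/3) cos φ = g(∇_X X, (∇_X J)PX)` and `(2/3) sin φ = g(∇_X X, J(∇_X J)PX)`. -/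
def IsAngle [IsManifold (𝓡 2) ∞ S] (F : S → E) (φ : ℝ) : Prop :=
  ∀ (U : Set S) (X : (x : S) → TangentSpace (𝓡 2) x), IsAdaptedField F U X → ∀ x ∈ U,
    2 / 3 * Real.cos φ = g (F x) (nablaXX F X x) (nablaJPX F X x) ∧
    2 / 3 * Real.sin φ = g (F x) (nablaXX F X x) (J (F x) (nablaJPX F X x))

end Surface

/-- `Φ` restricts to an isometry of `(SL₂ℝ × SL₂ℝ, g)` onto itself: a bijection, smooth (as a map
defined near `SL₂ℝ × SL₂ℝ`), whose differential preserves `g` on tangent vectors. -/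
structure IsIsometry (Φ : E → E) : Prop where
  bijOn : Set.BijOn Φ SL2SL2 SL2SL2
  smooth : ∀ a ∈ SL2SL2, ContDiffAt ℝ ∞ Φ a
  isometric : ∀ a ∈ SL2SL2, ∀ u ∈ tangentSL a, ∀ v ∈ tangentSL a,
    g (Φ a) (fderiv ℝ Φ a u) (fderiv ℝ Φ a v) = g a u v

end NKSL2

end

noncomputable section

namespace NKSL2

/-! ### The Lie algebra -/

/-! Left translation turns the problem into one about curves of frames in a Lie algebra. Write
`dF(X) = F ξ` with `ξ = (α, β)` in `sl₂ × sl₂`, and `⟨·,·⟩` for `inner4`, which has Lorentzian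
signature on `sl₂`. Degeneracy together with the two normalizations of `X` fixes the Gram matrix of
`α` and `β`: `⟨α,α⟩ = ⟨β,β⟩ = 1/2` and `⟨α,β⟩ = 1` (`IsFrame`). Hence `α`, `β` and `n = [α, β]` form
a basis of `sl₂`, with `n` orthogonal to `α` and `β`.

Let `Y = JX`. Symmetry of second derivatives of `F` expresses `dξ(Y)` through `dξ(X)` and `[X, Y]`
(`fderiv_frame_commutator`). Since the Gram matrix is constant along both fields, this forces `[X,
Y] = 0` and `dξ(X) = (a n, b n)` for functions `a`, `b`, and then `dξ(Y)` is determined by `a` and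
`b`. Symmetry of second derivatives of `ξ` gives the conic `a² - ab + b² - a + b = 0` and two first
order equations (`compatibility`). Differentiating the conic along `X` and `Y` yields a
nondegenerate homogeneous linear system for `da(X)`, `db(X)`, so `a` and `b` are locally constant
(`fderiv_coeff_eq_zero`).

The two functions defining the angle equal `-(a + b)/√3` and `a - b - 2/3`. In these coordinates the
conic is the circle of radius `2/3`, whence `φ`; as `X` is unique up to sign, and `a`, `b` are
insensitive to the sign, connectedness gives (i). Existence and uniqueness of `X` come from the fact
that `g(v, Pv) + i g(v, JPv)` is a complex quadratic form on the complex line `dF(T_xS)`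
(`pForm_comb`), nonzero because `P` does not preserve that line.

For (ii), `φ` determines `a` and `b`, and `(F, ξ)` is tangent to a plane field on `E × E` depending
only on them (`frameDist`). Any two frames are conjugate by one invertible matrix
(`IsFrame.exists_conj`), and translations combined with such a conjugation are isometries
(`exists_isometry`). So the initial values of the two surfaces can be matched, and integral surfaces
of a plane field through a common point coincide locally
(`exists_openPartialHomeomorph_of_integral`). -/

lemma Mat.trace_eq (x : Mat) : x.trace = x 0 0 + x 1 1 := Matrix.trace_fin_two x

lemma Mat.one_apply (i j : Fin 2) : (1 : Mat) i j = if i = j then 1 else 0 := by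
  change (1 : Matrix (Fin 2) (Fin 2) ℝ) i j = _
  rw [Matrix.one_apply]

lemma Mat.neg_apply (A : Mat) (i j : Fin 2) : (-A) i j = -A i j := rfl

lemma Mat.zero_apply (i j : Fin 2) : (0 : Mat) i j = 0 := rfl

lemma Mat.det_eq (x : Mat) : x.det = x 0 0 * x 1 1 - x 0 1 * x 1 0 := Matrix.det_fin_two x

lemma Mat.apply_one_one {x : Mat} (hx : x.trace = 0) : x 1 1 = -x 0 0 := by
  rw [Mat.trace_eq] at hx; linarith

lemma Mat.trace_lie (x y : Mat) : (x * y - y * x).trace = 0 := by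
  simp only [Mat.trace_eq, Mat.sub_apply, Mat.mul_apply]; ring

lemma inner4_add_left (x y z : Mat) : inner4 (x + y) z = inner4 x z + inner4 y z := by
  simp only [inner4, Mat.add_apply]; ring

lemma inner4_sub_left (x y z : Mat) : inner4 (x - y) z = inner4 x z - inner4 y z := by
  simp only [inner4, Mat.sub_apply]; ring

lemma inner4_smul_left (c : ℝ) (x z : Mat) : inner4 (c • x) z = c * inner4 x z := by
  simp only [inner4, Mat.smul_apply]; ring

lemma inner4_comm (x y : Mat) : inner4 x y = inner4 y x := by
  simp only [inner4]; ring

lemma inner4_add_right (x y z : Mat) : inner4 x (y + z) = inner4 x y + inner4 x z := by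
  simp only [inner4, Mat.add_apply]; ring

lemma inner4_sub_right (x y z : Mat) : inner4 x (y - z) = inner4 x y - inner4 x z := by
  simp only [inner4, Mat.sub_apply]; ring

lemma inner4_smul_right (c : ℝ) (x z : Mat) : inner4 x (c • z) = c * inner4 x z := by
  simp only [inner4, Mat.smul_apply]; ring

lemma inner4_zero_left (x : Mat) : inner4 0 x = 0 := by
  simp [inner4, Mat.zero_apply]

/-- The bilinear form `inner4`, bundled. -/
def inner4L : Mat →ₗ[ℝ] Mat →ₗ[ℝ] ℝ :=
  LinearMap.mk₂ ℝ inner4 inner4_add_left inner4_smul_left inner4_add_right inner4_smul_right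

/-- The triple product identity of `sl₂`. -/
lemma lie_lie_eq {x y z : Mat} (hx : x.trace = 0) (hy : y.trace = 0) (hz : z.trace = 0) :
    ((x * y - y * x) * z - z * (x * y - y * x)) =
      (4 * inner4 y z) • x - (4 * inner4 x z) • y := by
  replace hx := Mat.apply_one_one hx
  replace hy := Mat.apply_one_one hy
  replace hz := Mat.apply_one_one hz
  refine Mat.ext fun i j => ?_
  fin_cases i <;> fin_cases j <;>
  simp only [inner4, Mat.sub_apply, Mat.mul_apply, Mat.smul_apply, Fin.zero_eta, Fin.mk_one,
    Fin.isValue, hx, hy, hz] <;> ring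

lemma inner4_lie_left {x y : Mat} :
    inner4 (x * y - y * x) x = 0 := by
  simp only [inner4, Mat.sub_apply, Mat.mul_apply]; ring

lemma inner4_lie_right {x y : Mat} :
    inner4 (x * y - y * x) y = 0 := by
  simp only [inner4, Mat.sub_apply, Mat.mul_apply]; ring

/-! ### Frames in `sl₂`. -/

/-- The bracket of the two components of an element of `sl₂ × sl₂`. -/
def nrm (ξ : E) : Mat := ξ.1 * ξ.2 - ξ.2 * ξ.1

/-- Both components have trace zero. -/
def IsTraceless (ξ : E) : Prop := ξ.1.trace = 0 ∧ ξ.2.trace = 0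

/-- The Gram matrix of the components of the left trivialisation of a normalized vector of a
degenerate almost complex surface. -/
structure IsFrame (ξ : E) : Prop where
  traceless : IsTraceless ξ
  fst : inner4 ξ.1 ξ.1 = 1 / 2
  snd : inner4 ξ.2 ξ.2 = 1 / 2
  fst_snd : inner4 ξ.1 ξ.2 = 1

lemma nrm_trace (ξ : E) : (nrm ξ).trace = 0 := Mat.trace_lie _ _

lemma IsFrame.nrm_fst {ξ : E} (h : IsFrame ξ) :
    nrm ξ * ξ.1 - ξ.1 * nrm ξ = (4 : ℝ) • ξ.1 - (2 : ℝ) • ξ.2 := by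
  rw [nrm, lie_lie_eq h.traceless.1 h.traceless.2 h.traceless.1, inner4_comm ξ.2, h.fst, h.fst_snd]
  norm_num

lemma IsFrame.nrm_snd {ξ : E} (h : IsFrame ξ) :
    nrm ξ * ξ.2 - ξ.2 * nrm ξ = (2 : ℝ) • ξ.1 - (4 : ℝ) • ξ.2 := by
  rw [nrm, lie_lie_eq h.traceless.1 h.traceless.2 h.traceless.2, h.snd, h.fst_snd]
  norm_num

lemma inner4_lie_lie {x y : Mat} (hx : x.trace = 0) (hy : y.trace = 0) :
    inner4 (x * y - y * x) (x * y - y * x) = 4 * inner4 x y ^ 2 - 4 * inner4 x x * inner4 y y := by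
  replace hx := Mat.apply_one_one hx
  replace hy := Mat.apply_one_one hy
  simp only [inner4, Mat.sub_apply, Mat.mul_apply, hx, hy]; ring

lemma IsFrame.nrm_nrm {ξ : E} (h : IsFrame ξ) : inner4 (nrm ξ) (nrm ξ) = 3 := by
  rw [nrm, inner4_lie_lie h.traceless.1 h.traceless.2, h.fst, h.snd, h.fst_snd]; norm_num

/-- A vector of `sl₂` orthogonal to both components of a frame is a multiple of their bracket. -/
lemma IsFrame.eq_smul_nrm {ξ : E} (h : IsFrame ξ) {γ : Mat} (hγ : γ.trace = 0)
    (h1 : inner4 γ ξ.1 = 0) (h2 : inner4 γ ξ.2 = 0) :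
    γ = (1 / 3 * inner4 γ (nrm ξ)) • nrm ξ := by
  -- The triple product identity gives `[n, γ] = 0` because `γ` is orthogonal to both components.
  -- Applied to `[[n, γ], n]` it then gives `⟨n, n⟩ γ = ⟨γ, n⟩ n`, where `⟨n, n⟩ = 3`.
  have e1 := lie_lie_eq h.traceless.1 h.traceless.2 hγ
  rw [inner4_comm _ γ, h2, inner4_comm _ γ, h1, ← nrm] at e1
  simp only [mul_zero, zero_smul, sub_zero] at e1
  have e2 := lie_lie_eq (nrm_trace ξ) hγ (nrm_trace ξ)
  rw [e1, h.nrm_nrm] at e2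
  simp only [mul_zero, zero_mul, sub_zero] at e2
  have e3 : (12 : ℝ) • γ = (4 * inner4 γ (nrm ξ)) • nrm ξ := by
    rw [eq_comm, sub_eq_zero] at e2; rw [e2]; norm_num
  calc γ = (1 / 12 : ℝ) • ((12 : ℝ) • γ) := by rw [smul_smul]; norm_num
    _ = _ := by rw [e3, smul_smul]; congr 1; ring

/-! ### Algebra of `jAlg`, `pAlg` and `gAlg`; the normalization. -/

lemma jAlg_fst (ξ : E) : (jAlg ξ).1 = (1 / √3 : ℝ) • (ξ.1 - (2 : ℝ) • ξ.2) := rfl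
lemma jAlg_snd (ξ : E) : (jAlg ξ).2 = (1 / √3 : ℝ) • ((2 : ℝ) • ξ.1 - ξ.2) := rfl
lemma pAlg_fst (ξ : E) : (pAlg ξ).1 = ξ.2 := rfl
lemma pAlg_snd (ξ : E) : (pAlg ξ).2 = ξ.1 := rfl

lemma inv_sqrt_three_mul_self : (1 / √3 : ℝ) * (1 / √3) = 1 / 3 := by
  rw [div_mul_div_comm, Real.mul_self_sqrt (by norm_num)]; norm_num

lemma jAlg_jAlg (ξ : E) : jAlg (jAlg ξ) = -ξ := by
  have h := inv_sqrt_three_mul_self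
  ext1
  · rw [jAlg_fst, jAlg_fst, jAlg_snd, Prod.fst_neg]
    generalize (1 / √3 : ℝ) = s at h
    match_scalars <;> first | linear_combination (-3) * h | ring
  · rw [jAlg_snd, jAlg_fst, jAlg_snd, Prod.snd_neg]
    generalize (1 / √3 : ℝ) = s at h
    match_scalars <;> first | linear_combination (-3) * h | ring

lemma pAlg_jAlg (ξ : E) : pAlg (jAlg ξ) = -jAlg (pAlg ξ) := by
  ext1
  · simp only [jAlg_fst, jAlg_snd, pAlg_fst, pAlg_snd, Prod.fst_neg]; module
  · simp only [jAlg_fst, jAlg_snd, pAlg_fst, pAlg_snd, Prod.snd_neg]; module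

lemma gAlg_eq_inner4 (ξ η : E) : gAlg ξ η = 2 / 3 * (inner4 ξ.1 η.1 + inner4 ξ.2 η.2) -
    1 / 3 * (inner4 ξ.2 η.1 + inner4 ξ.1 η.2) := by
  rw [gAlg_eq]; rfl

lemma gAlg_self (ξ : E) : gAlg ξ ξ =
    2 / 3 * (inner4 ξ.1 ξ.1 + inner4 ξ.2 ξ.2 - inner4 ξ.1 ξ.2) := by
  rw [gAlg_eq_inner4, inner4_comm ξ.2 ξ.1]; ring

lemma gAlg_pAlg (ξ : E) : gAlg ξ (pAlg ξ) =
    4 / 3 * inner4 ξ.1 ξ.2 - 1 / 3 * (inner4 ξ.1 ξ.1 + inner4 ξ.2 ξ.2) := by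
  rw [gAlg_eq_inner4, pAlg_fst, pAlg_snd, inner4_comm ξ.2 ξ.1]; ring

lemma gAlg_jAlg_pAlg (ξ : E) : gAlg ξ (jAlg (pAlg ξ)) =
    1 / √3 * (inner4 ξ.2 ξ.2 - inner4 ξ.1 ξ.1) := by
  rw [gAlg_eq_inner4, jAlg_fst, jAlg_snd, pAlg_fst, pAlg_snd]
  simp only [inner4_smul_right, inner4_sub_right, inner4_comm ξ.2 ξ.1]
  ring

/-- The three values of `gAlg` are independent linear combinations of the three Gram entries of the
components, so they determine these entries. -/
lemma isFrame_of_gAlg {ξ : E} (ht : IsTraceless ξ) (h0 : gAlg ξ ξ = 0) (h1 : gAlg ξ (pAlg ξ) = 1)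
    (h2 : gAlg ξ (jAlg (pAlg ξ)) = 0) : IsFrame ξ := by
  rw [gAlg_self] at h0
  rw [gAlg_pAlg] at h1
  have h3 : inner4 ξ.2 ξ.2 - inner4 ξ.1 ξ.1 = 0 := by
    rw [gAlg_jAlg_pAlg] at h2
    exact (mul_eq_zero.1 h2).resolve_left (by positivity)
  exact ⟨ht, by linarith, by linarith, by linarith⟩

lemma gAlg_add_left (x y z : E) : gAlg (x + y) z = gAlg x z + gAlg y z := by
  simp only [gAlg_eq_inner4, Prod.fst_add, Prod.snd_add, inner4_add_left]; ring

lemma gAlg_smul_left (c : ℝ) (x z : E) : gAlg (c • x) z = c * gAlg x z := by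
  simp only [gAlg_eq_inner4, Prod.smul_fst, Prod.smul_snd, inner4_smul_left]; ring

lemma gAlg_comm (x y : E) : gAlg x y = gAlg y x := by
  simp only [gAlg_eq_inner4, inner4_comm y.1, inner4_comm y.2]; ring

lemma gAlg_add_right (x y z : E) : gAlg x (y + z) = gAlg x y + gAlg x z := by
  simp only [gAlg_comm x, gAlg_add_left]

lemma gAlg_smul_right (c : ℝ) (x z : E) : gAlg x (c • z) = c * gAlg x z := by
  simp only [gAlg_comm x, gAlg_smul_left]

lemma gAlg_neg_right (x z : E) : gAlg x (-z) = -gAlg x z := by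
  rw [← neg_one_smul ℝ z, gAlg_smul_right]; ring

lemma gAlg_jAlg_jAlg (x y : E) : gAlg (jAlg x) (jAlg y) = gAlg x y := by
  have h : prodMetric (-x) (-y) = prodMetric x y := by
    simp [prodMetric, inner4, Mat.neg_apply]
  rw [gAlg, gAlg, jAlg_jAlg, jAlg_jAlg, h]; ring

lemma gAlg_jAlg_left (x y : E) : gAlg (jAlg x) y = -gAlg x (jAlg y) := by
  rw [← gAlg_jAlg_jAlg (x := x), jAlg_jAlg, gAlg_neg_right, neg_neg]

/-- `P` anticommutes with `J`, so multiplying `ξ` by `p + iq` multiplies the pair of `P`-data by `(p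
+ iq)²`. This is the real part; `gAlg_jAlg_pAlg_comb` is the imaginary part. -/
lemma gAlg_pAlg_comb (ξ : E) (p q : ℝ) :
    gAlg (p • ξ + q • jAlg ξ) (pAlg (p • ξ + q • jAlg ξ)) =
      (p ^ 2 - q ^ 2) * gAlg ξ (pAlg ξ) - 2 * p * q * gAlg ξ (jAlg (pAlg ξ)) := by
  simp only [map_add, map_smul, pAlg_jAlg, gAlg_add_left, gAlg_add_right, gAlg_smul_left,
    gAlg_smul_right, gAlg_neg_right, gAlg_jAlg_left, jAlg_jAlg]
  ring

lemma gAlg_jAlg_pAlg_comb (ξ : E) (p q : ℝ) :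
    gAlg (p • ξ + q • jAlg ξ) (jAlg (pAlg (p • ξ + q • jAlg ξ))) =
      (p ^ 2 - q ^ 2) * gAlg ξ (jAlg (pAlg ξ)) + 2 * p * q * gAlg ξ (pAlg ξ) := by
  simp only [map_add, map_smul, map_neg, pAlg_jAlg, gAlg_add_left, gAlg_add_right, gAlg_smul_left,
    gAlg_smul_right, gAlg_neg_right, gAlg_jAlg_left, jAlg_jAlg]
  ring

/-- If the `P`-data of an isotropic vector vanish, then `P` preserves its `J`-complex line. -/
lemma pAlg_mem_of_gAlg_eq_zero {ξ : E} (ht : IsTraceless ξ) (h0 : gAlg ξ ξ = 0)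
    (h1 : gAlg ξ (pAlg ξ) = 0) (h2 : gAlg ξ (jAlg (pAlg ξ)) = 0) :
    ∃ p q : ℝ, pAlg ξ = p • ξ + q • jAlg ξ := by
  rw [gAlg_self] at h0
  rw [gAlg_pAlg] at h1
  have h3 : inner4 ξ.2 ξ.2 - inner4 ξ.1 ξ.1 = 0 := by
    rw [gAlg_jAlg_pAlg] at h2
    exact (mul_eq_zero.1 h2).resolve_left (by positivity)
  have a1 : inner4 ξ.1 ξ.1 = 0 := by linarith
  have a2 : inner4 ξ.2 ξ.2 = 0 := by linarith
  have a3 : inner4 ξ.1 ξ.2 = 0 := by linarith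
  have t1 := Mat.apply_one_one ht.1
  have t2 := Mat.apply_one_one ht.2
  -- The components now span a totally isotropic subspace, which in Lorentzian signature is at most
  -- a line.
  have hpar : (∃ c : ℝ, ξ.2 = c • ξ.1) ∨ ξ.1 = 0 := by
    rw [or_iff_not_imp_right]
    intro hne
    simp only [inner4, t1, t2] at a1 a2 a3
    by_cases hy : ξ.1 0 1 = 0
    · have hx : ξ.1 0 0 = 0 := by
        have : ξ.1 0 0 ^ 2 = 0 := by rw [hy] at a1; linarith
        exact pow_eq_zero_iff (two_ne_zero) |>.1 this
      have hz : ξ.1 1 0 ≠ 0 := fun hz => hne (Mat.ext fun i j => by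
        fin_cases i <;> fin_cases j <;> simp [hx, hy, hz, t1, Mat.zero_apply])
      have hb : ξ.2 0 1 = 0 := by
        have : ξ.1 1 0 * ξ.2 0 1 = 0 := by rw [hx, hy] at a3; linarith
        exact (mul_eq_zero.1 this).resolve_left hz
      have hb2 : ξ.2 0 0 = 0 := by
        have : ξ.2 0 0 ^ 2 = 0 := by rw [hb] at a2; linarith
        exact pow_eq_zero_iff (two_ne_zero) |>.1 this
      refine ⟨ξ.2 1 0 / ξ.1 1 0, Mat.ext fun i j => ?_⟩
      fin_cases i <;> fin_cases j <;> simp [hx, hy, hz, hb, hb2, t1, t2, Mat.smul_apply]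
    · refine ⟨ξ.2 0 1 / ξ.1 0 1, ?_⟩
      have e1 : ξ.2 0 0 * ξ.1 0 1 = ξ.2 0 1 * ξ.1 0 0 := by
        have : (ξ.2 0 0 * ξ.1 0 1 - ξ.2 0 1 * ξ.1 0 0) ^ 2 = 0 := by
          linear_combination (ξ.1 0 1) ^ 2 * a2 + (ξ.2 0 1) ^ 2 * a1 -
            2 * (ξ.1 0 1) * (ξ.2 0 1) * a3
        linarith [pow_eq_zero_iff (two_ne_zero) |>.1 this]
      have e2 : ξ.2 1 0 * ξ.1 0 1 = ξ.2 0 1 * ξ.1 1 0 := by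
        have : ξ.1 0 1 * (ξ.2 1 0 * ξ.1 0 1 - ξ.2 0 1 * ξ.1 1 0) = 0 := by
          linear_combination 2 * (ξ.1 0 1) * a3 - 2 * ξ.2 0 1 * a1 - 2 * ξ.1 0 0 * e1
        linarith [(mul_eq_zero.1 this).resolve_left hy]
      refine Mat.ext fun i j => ?_
      fin_cases i <;> fin_cases j <;> simp [t1, t2, Mat.smul_apply] <;> field_simp <;> linarith
  have h := inv_sqrt_three_mul_self
  rcases hpar with ⟨c, hc⟩ | hc
  · have hd : 1 - c + c ^ 2 ≠ 0 := by nlinarith [sq_nonneg (c - 1), sq_nonneg c]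
    -- Cramer's rule for the coordinates of `(c, 1)` in the basis `(1, c)`, `J(1, c)`, whose
    -- determinant is `2 (1 - c + c²) / √3`.
    refine ⟨(4 * c - c ^ 2 - 1) / (2 * (1 - c + c ^ 2)),
      3 * (1 / √3) * (1 - c ^ 2) / (2 * (1 - c + c ^ 2)), ?_⟩
    generalize hs : (1 / √3 : ℝ) = s at h
    ext1
    · simp only [pAlg_fst, Prod.fst_add, Prod.smul_fst, jAlg_fst, hc, hs]
      match_scalars
      field_simp
      linear_combination (-3) * (1 - c ^ 2) * (1 - 2 * c) * h
    · simp only [pAlg_snd, Prod.snd_add, Prod.smul_snd, jAlg_snd, hc, hs]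
      match_scalars
      field_simp
      linear_combination (-3) * (1 - c ^ 2) * (2 - c) * h
  -- The limit `c → ∞` of the previous coefficients.
  · refine ⟨-(1 / 2), -(3 / 2) * (1 / √3), ?_⟩
    generalize hs : (1 / √3 : ℝ) = s at h
    ext1
    · simp only [pAlg_fst, Prod.fst_add, Prod.smul_fst, jAlg_fst, hc, hs]
      match_scalars
      linear_combination (-3) * h
    · simp only [pAlg_snd, Prod.snd_add, Prod.smul_snd, jAlg_snd, hc, hs]
      match_scalars
      linear_combination (-3 / 2) * h

/-! ### The connection on frames and the two angle functions. -/

lemma Γ_self (ξ : E) : Γ ξ ξ = ((-(1 / 3) : ℝ) • nrm ξ, (1 / 3 : ℝ) • nrm ξ) := by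
  ext1 <;> simp [Γ, nrm] <;> module

lemma Γ_jAlg_pAlg (ξ : E) : Γ ξ (jAlg (pAlg ξ)) - jAlg (Γ ξ (pAlg ξ)) =
    (-(1 / √3) : ℝ) • (nrm ξ, nrm ξ) := by
  ext1
  · simp only [Γ, nrm, jAlg_fst, jAlg_snd, pAlg_fst, pAlg_snd, Prod.fst_add, Prod.snd_add,
      Prod.fst_sub, Prod.snd_sub, Prod.fst_mul, Prod.snd_mul, Prod.smul_fst, Prod.smul_snd,
      mul_sub, sub_mul, smul_mul_assoc, mul_smul_comm]
    module
  · simp only [Γ, nrm, jAlg_fst, jAlg_snd, pAlg_fst, pAlg_snd, Prod.fst_add, Prod.snd_add,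
      Prod.fst_sub, Prod.snd_sub, Prod.fst_mul, Prod.snd_mul, Prod.smul_fst, Prod.smul_snd,
      mul_sub, sub_mul, smul_mul_assoc, mul_smul_comm]
    module

/-- The two numbers in `IsAngle`, in terms of the derivative `(a n, b n)` of the frame. -/
lemma IsFrame.angle {ξ : E} (h : IsFrame ξ) (a b : ℝ) :
    gAlg ((a • nrm ξ, b • nrm ξ) + Γ ξ ξ) (Γ ξ (jAlg (pAlg ξ)) - jAlg (Γ ξ (pAlg ξ))) =
      -(1 / √3) * (a + b) ∧
    gAlg ((a • nrm ξ, b • nrm ξ) + Γ ξ ξ) (jAlg (Γ ξ (jAlg (pAlg ξ)) - jAlg (Γ ξ (pAlg ξ)))) =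
      a - b - 2 / 3 := by
  have hs := inv_sqrt_three_mul_self
  rw [Γ_jAlg_pAlg, Γ_self]
  constructor
  · simp only [gAlg_eq_inner4, Prod.fst_add, Prod.snd_add, Prod.smul_fst, Prod.smul_snd,
      inner4_add_left, inner4_smul_left, inner4_smul_right, h.nrm_nrm]
    ring
  · simp only [gAlg_eq_inner4, Prod.fst_add, Prod.snd_add, Prod.smul_fst, Prod.smul_snd, jAlg_fst,
      jAlg_snd, inner4_add_left, inner4_smul_left, inner4_smul_right, inner4_sub_right, h.nrm_nrm]
    linear_combination (3 * (a - b) - 2) * hs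

/-! ### Calculus preliminaries -/

/-- The model space of surfaces. -/
abbrev Plane : Type := EuclideanSpace ℝ (Fin 2)

section Calculus

variable {V : Type*} [NormedAddCommGroup V] [NormedSpace ℝ V]
  {V' : Type*} [NormedAddCommGroup V'] [NormedSpace ℝ V']

/-- The commutator of two derivations is the derivation along the Lie bracket. -/
lemma fderiv_fderiv_apply_sub {h : V → V'} {X Y : V → V} {u : V} (hh : ContDiffAt ℝ ∞ h u)
    (hX : DifferentiableAt ℝ X u) (hY : DifferentiableAt ℝ Y u) :
    fderiv ℝ (fun x => fderiv ℝ h x (Y x)) u (X u) - fderiv ℝ (fun x => fderiv ℝ h x (X x)) u (Y u)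
      = fderiv ℝ h u (fderiv ℝ Y u (X u) - fderiv ℝ X u (Y u)) := by
  have h1 : DifferentiableAt ℝ (fderiv ℝ h) u :=
    ((hh.of_le (m := 2) ENat.LEInfty.out).fderiv_right (m := 1) le_rfl).differentiableAt
      one_ne_zero
  have hs : IsSymmSndFDerivAt ℝ h u := hh.isSymmSndFDerivAt (by
    simp only [minSmoothness_of_isRCLikeNormedField]; exact ENat.LEInfty.out)
  rw [fderiv_clm_apply h1 hY, fderiv_clm_apply h1 hX]
  simp only [add_apply, ContinuousLinearMap.comp_apply,
    ContinuousLinearMap.flip_apply, map_sub]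
  rw [hs.eq (X u) (Y u)]
  abel

lemma exists_hasFDerivAt_bilinear {G : Type*} [NormedAddCommGroup G] [NormedSpace ℝ G]
    [FiniteDimensional ℝ G] (B : G →ₗ[ℝ] G →ₗ[ℝ] ℝ) {α β : V → G} {α' β' : V →L[ℝ] G} {u : V}
    (hα : HasFDerivAt α α' u) (hβ : HasFDerivAt β β' u) :
    ∃ L : V →L[ℝ] ℝ, HasFDerivAt (fun x => B (α x) (β x)) L u ∧
      ∀ v, L v = B (α' v) (β u) + B (α u) (β' v) := by
  refine ⟨_, B.toContinuousBilinearMap.hasFDerivAt_of_bilinear hα hβ, fun v => ?_⟩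
  rw [add_comm]
  rfl

lemma contDiffOn_bilinear {G : Type*} [NormedAddCommGroup G] [NormedSpace ℝ G]
    [FiniteDimensional ℝ G] (B : G →ₗ[ℝ] G →ₗ[ℝ] ℝ) {α β : V → G} {W : Set V}
    (hα : ContDiffOn ℝ ∞ α W) (hβ : ContDiffOn ℝ ∞ β W) :
    ContDiffOn ℝ ∞ (fun x => B (α x) (β x)) W :=
  (B.toContinuousBilinearMap.contDiff.comp_contDiffOn hα).clm_apply hβ

lemma HasFDerivAt.inner4 {α β : V → Mat} {α' β' : V →L[ℝ] Mat} {u : V} (hα : HasFDerivAt α α' u)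
    (hβ : HasFDerivAt β β' u) : ∃ L : V →L[ℝ] ℝ, HasFDerivAt (fun x => inner4 (α x) (β x)) L u ∧
      ∀ v, L v = NKSL2.inner4 (α' v) (β u) + NKSL2.inner4 (α u) (β' v) :=
  exists_hasFDerivAt_bilinear inner4L hα hβ

lemma ContDiffOn.inner4 {α β : V → Mat} {W : Set V} (hα : ContDiffOn ℝ ∞ α W)
    (hβ : ContDiffOn ℝ ∞ β W) : ContDiffOn ℝ ∞ (fun x => inner4 (α x) (β x)) W :=
  contDiffOn_bilinear inner4L hα hβ

lemma inner4_derivative {ξ : V → E} {ξ' : V →L[ℝ] E} {u : V} (h : HasFDerivAt ξ ξ' u)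
    {W : Set V} (hW : W ∈ 𝓝 u) (l l' : E →L[ℝ] Mat) {c : ℝ}
    (hc : ∀ x ∈ W, inner4 (l (ξ x)) (l' (ξ x)) = c) (v : V) :
    inner4 (l (ξ' v)) (l' (ξ u)) + inner4 (l (ξ u)) (l' (ξ' v)) = 0 := by
  obtain ⟨L, hL, hL'⟩ := HasFDerivAt.inner4 (l.hasFDerivAt.comp u h) (l'.hasFDerivAt.comp u h)
  have h0 : HasFDerivAt (fun x => inner4 (l (ξ x)) (l' (ξ x))) (0 : V →L[ℝ] ℝ) u :=
    (hasFDerivAt_const c u).congr_of_eventuallyEq (Filter.mem_of_superset hW fun x hx => hc x hx)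
  have := hL' v
  rw [hL.unique h0] at this
  exact this.symm

/-- A solution of a smooth family of injective linear equations is smooth. -/
lemma contDiffAt_of_clm_apply_eq [FiniteDimensional ℝ V] [FiniteDimensional ℝ V']
    {U : Type*} [NormedAddCommGroup U] [NormedSpace ℝ U]
    {A : U → V →L[ℝ] V'} {Y : U → V} {Z : U → V'} {u : U} (hA : ContDiffAt ℝ ∞ A u)
    (hZ : ContDiffAt ℝ ∞ Z u) (hinj : Function.Injective (A u))
    (h : ∀ᶠ x in 𝓝 u, A x (Y x) = Z x) : ContDiffAt ℝ ∞ Y u := by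
  have : CompleteSpace V := FiniteDimensional.complete ℝ V
  -- Composing with a left inverse of `A u` makes the system square; it remains invertible near `u`,
  -- and inversion of linear maps is smooth.
  obtain ⟨π, hπ⟩ := (A u).toLinearMap.exists_leftInverse_of_injective
    (LinearMap.ker_eq_bot.2 hinj)
  set π' : V' →L[ℝ] V := π.toContinuousLinearMap
  have h0 : π' ∘L A u = ContinuousLinearEquiv.refl ℝ V := by
    ext v; exact congrArg (fun l => l v) hπ
  have hB : ContDiffAt ℝ ∞ (fun x => π' ∘L A x) u := contDiffAt_const.clm_comp hA
  have hinv : ∀ᶠ x in 𝓝 u, (π' ∘L A x) ∈ Set.range ((↑) : (V ≃L[ℝ] V) → V →L[ℝ] V) := by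
    refine hB.continuousAt.eventually (p := fun y => y ∈ Set.range _) ?_
    beta_reduce
    rw [h0]
    exact ContinuousLinearEquiv.nhds _
  have hI : ContDiffAt ℝ ∞ (fun x => (π' ∘L A x).inverse (π' (Z x))) u := by
    refine ContDiffAt.clm_apply (ContDiffAt.comp (g := ContinuousLinearMap.inverse) u ?_ hB)
      (contDiffAt_const.clm_apply hZ)
    rw [h0]; exact contDiffAt_map_inverse _
  refine hI.congr_of_eventuallyEq ?_
  filter_upwards [h, hinv] with x hx ⟨e, he⟩
  rw [← he, ContinuousLinearMap.inverse_equiv, ← hx]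
  refine (e.symm_apply_apply (Y x)).symm.trans (congrArg e.symm ?_)
  exact congrArg (fun l => l (Y x)) he

lemma exists_eq_smul_add_smul {P : Type*} [AddCommGroup P] [Module ℝ P]
    (hd : Module.finrank ℝ P = 2) {v w : P} (h : ∀ s t : ℝ, s • v + t • w = 0 → s = 0 ∧ t = 0)
    (z : P) : ∃ p q : ℝ, z = p • v + q • w := by
  have hli : LinearIndependent ℝ ![v, w] := LinearIndependent.pair_iff.2 h
  have : z ∈ Submodule.span ℝ (Set.range ![v, w]) := by
    rw [hli.span_eq_top_of_card_eq_finrank (by simp [hd])]; trivial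
  rw [Matrix.range_cons, Matrix.range_cons, Matrix.range_empty, Set.union_empty,
    Set.singleton_union, Submodule.mem_span_pair] at this
  obtain ⟨p, q, h⟩ := this
  exact ⟨p, q, h.symm⟩

end Calculus

lemma leftMul_apply (a z : E) : leftMul a z = a * z := rfl

lemma eq_of_mul_eq {a : E} (ha : a ∈ SL2SL2) {x y : E} (h : a * x = a * y) : x = y := by
  rw [← leftTriv_leftMul ha x, ← leftTriv_leftMul ha y, leftMul_apply, leftMul_apply, h]

lemma IsFrame.ne_zero {ξ : E} (h : IsFrame ξ) : ξ ≠ 0 := by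
  rintro rfl
  simpa [inner4, Mat.zero_apply] using h.fst

/-- Since `J² = -1`, applying `s - tJ` to the relation leaves `(s² + t²) ξ = 0`. -/
lemma jAlg_independent {ξ : E} (h : ξ ≠ 0) (s t : ℝ) (hst : s • ξ + t • jAlg ξ = 0) :
    s = 0 ∧ t = 0 := by
  have h1 : s • jAlg ξ - t • ξ = 0 := by
    have := congrArg jAlg hst
    simpa [map_add, map_smul, jAlg_jAlg, ← sub_eq_add_neg] using this
  have h2 : (s ^ 2 + t ^ 2) • ξ = 0 := by
    calc (s ^ 2 + t ^ 2) • ξ = s • (s • ξ + t • jAlg ξ) - t • (s • jAlg ξ - t • ξ) := by module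
      _ = 0 := by rw [hst, h1]; simp
  have h3 := (smul_eq_zero.1 h2).resolve_right h
  exact ⟨pow_eq_zero_iff two_ne_zero |>.1 (by nlinarith [sq_nonneg s, sq_nonneg t]),
    pow_eq_zero_iff two_ne_zero |>.1 (by nlinarith [sq_nonneg s, sq_nonneg t])⟩

/-! ### Framed surfaces -/

/-- A surface in a coordinate domain `W`, with a normalized field `X`, the field `Y = JX`, and the
left trivialisation `ξ` of `X`. -/
structure IsFramedSurface (W : Set Plane) (f : Plane → E) (X Y : Plane → Plane) (ξ : Plane → E) :
    Prop where
  isOpen : IsOpen W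
  mem : ∀ u ∈ W, f u ∈ SL2SL2
  smooth : ContDiffOn ℝ ∞ f W
  smoothX : ContDiffOn ℝ ∞ X W
  smoothY : ContDiffOn ℝ ∞ Y W
  smoothξ : ContDiffOn ℝ ∞ ξ W
  fderiv_X : ∀ u ∈ W, fderiv ℝ f u (X u) = f u * ξ u
  fderiv_Y : ∀ u ∈ W, fderiv ℝ f u (Y u) = f u * jAlg (ξ u)
  frame : ∀ u ∈ W, IsFrame (ξ u)

namespace IsFramedSurface

variable {W : Set Plane} {f : Plane → E} {X Y : Plane → Plane} {ξ : Plane → E}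

lemma comb (h : IsFramedSurface W f X Y ξ) {u : Plane} (hu : u ∈ W) (v : Plane) :
    ∃ p q : ℝ, v = p • X u + q • Y u := by
  refine exists_eq_smul_add_smul (by simp) (fun s t hst => ?_) v
  refine jAlg_independent (h.frame u hu).ne_zero s t (eq_of_mul_eq (h.mem u hu) ?_)
  have := congrArg (fderiv ℝ f u) hst
  simpa [map_add, map_smul, h.fderiv_X u hu, h.fderiv_Y u hu, mul_add, mul_smul_comm] using this

/-- The derivative of the first component along `X`, as a multiple of the bracket. -/
def coeffA (ξ : Plane → E) (X : Plane → Plane) (u : Plane) : ℝ :=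
  1 / 3 * inner4 (fderiv ℝ ξ u (X u)).1 (nrm (ξ u))

/-- The derivative of the second component along `X`, as a multiple of the bracket. -/
def coeffB (ξ : Plane → E) (X : Plane → Plane) (u : Plane) : ℝ :=
  1 / 3 * inner4 (fderiv ℝ ξ u (X u)).2 (nrm (ξ u))

section
variable (h : IsFramedSurface W f X Y ξ) {u : Plane} (hu : u ∈ W)
include h hu

lemma hasFDerivAt_frame : HasFDerivAt ξ (fderiv ℝ ξ u) u :=
  ((h.smoothξ.contDiffAt (h.isOpen.mem_nhds hu)).differentiableAt (by simp)).hasFDerivAt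

lemma inner4_fst (v : Plane) : inner4 (fderiv ℝ ξ u v).1 (ξ u).1 = 0 := by
  have := inner4_derivative (h.hasFDerivAt_frame hu) (h.isOpen.mem_nhds hu)
    (ContinuousLinearMap.fst ℝ Mat Mat) (ContinuousLinearMap.fst ℝ Mat Mat)
    (fun x hx => (h.frame x hx).fst) v
  simp only [ContinuousLinearMap.coe_fst'] at this
  rw [inner4_comm (ξ u).1] at this
  linarith

lemma inner4_snd (v : Plane) : inner4 (fderiv ℝ ξ u v).2 (ξ u).2 = 0 := by
  have := inner4_derivative (h.hasFDerivAt_frame hu) (h.isOpen.mem_nhds hu)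
    (ContinuousLinearMap.snd ℝ Mat Mat) (ContinuousLinearMap.snd ℝ Mat Mat)
    (fun x hx => (h.frame x hx).snd) v
  simp only [ContinuousLinearMap.coe_snd'] at this
  rw [inner4_comm (ξ u).2] at this
  linarith

lemma inner4_fst_snd (v : Plane) :
    inner4 (fderiv ℝ ξ u v).2 (ξ u).1 = -inner4 (fderiv ℝ ξ u v).1 (ξ u).2 := by
  have := inner4_derivative (h.hasFDerivAt_frame hu) (h.isOpen.mem_nhds hu)
    (ContinuousLinearMap.fst ℝ Mat Mat) (ContinuousLinearMap.snd ℝ Mat Mat)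
    (fun x hx => (h.frame x hx).fst_snd) v
  simp only [ContinuousLinearMap.coe_fst', ContinuousLinearMap.coe_snd'] at this
  rw [inner4_comm (ξ u).1] at this
  linarith

lemma traceless (v : Plane) : IsTraceless (fderiv ℝ ξ u v) := by
  have key : ∀ l : E →L[ℝ] Mat, (∀ x ∈ W, (l (ξ x)).trace = 0) → (l (fderiv ℝ ξ u v)).trace = 0 := by
    intro l hl
    let t : Mat →L[ℝ] ℝ := (Matrix.traceLinearMap (Fin 2) ℝ ℝ : Mat →ₗ[ℝ] ℝ).toContinuousLinearMap
    have h1 := (t ∘L l).hasFDerivAt.comp u (h.hasFDerivAt_frame hu)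
    have h0 : HasFDerivAt (fun x => (t ∘L l) (ξ x)) (0 : Plane →L[ℝ] ℝ) u :=
      (hasFDerivAt_const 0 u).congr_of_eventuallyEq
        (Filter.mem_of_superset (h.isOpen.mem_nhds hu) fun x hx => hl x hx)
    exact congrArg (fun l => l v) (h1.unique h0)
  exact ⟨key (ContinuousLinearMap.fst ℝ Mat Mat) fun x hx => (h.frame x hx).traceless.1,
    key (ContinuousLinearMap.snd ℝ Mat Mat) fun x hx => (h.frame x hx).traceless.2⟩

/-- The Maurer–Cartan equation: the identity `XYf - YXf = [X, Y]f`, with `Xf = f ξ` and `Yf = f Jξ`,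
divided by `f` on the left. -/
lemma fderiv_frame_commutator {p q : ℝ}
    (hpq : fderiv ℝ Y u (X u) - fderiv ℝ X u (Y u) = p • X u + q • Y u) :
    fderiv ℝ ξ u (Y u) = jAlg (fderiv ℝ ξ u (X u)) + (ξ u * jAlg (ξ u) - jAlg (ξ u) * ξ u) -
      p • ξ u - q • jAlg (ξ u) := by
  have hf := h.smooth.contDiffAt (h.isOpen.mem_nhds hu)
  have hf' := (hf.differentiableAt (by simp)).hasFDerivAt
  have hX := (h.smoothX.contDiffAt (h.isOpen.mem_nhds hu)).differentiableAt (by simp)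
  have hY := (h.smoothY.contDiffAt (h.isOpen.mem_nhds hu)).differentiableAt (by simp)
  have h1 := fderiv_fderiv_apply_sub hf hX hY
  let j : E →L[ℝ] E := jAlg.toContinuousLinearMap
  have eX : (fun x => fderiv ℝ f x (X x)) =ᶠ[𝓝 u] fun x => f x * ξ x :=
    Filter.mem_of_superset (h.isOpen.mem_nhds hu) h.fderiv_X
  have eY : (fun x => fderiv ℝ f x (Y x)) =ᶠ[𝓝 u] fun x => f x * j (ξ x) :=
    Filter.mem_of_superset (h.isOpen.mem_nhds hu) h.fderiv_Y
  have e1 : HasFDerivAt (fun x => f x * ξ x) _ u := hf'.mul' (h.hasFDerivAt_frame hu)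
  have e2 : HasFDerivAt (fun x => f x * j (ξ x)) _ u :=
    hf'.mul' (j.hasFDerivAt.comp u (h.hasFDerivAt_frame hu))
  rw [eX.fderiv_eq, eY.fderiv_eq, hpq, e1.fderiv, e2.fderiv] at h1
  simp only [add_apply, smul_apply, smul_eq_mul,
    MulOpposite.smul_eq_mul_unop, MulOpposite.unop_op, ContinuousLinearMap.comp_apply, map_add,
    map_smul, h.fderiv_X u hu, h.fderiv_Y u hu] at h1
  have hj : ∀ z, j z = jAlg z := fun _ => rfl
  simp only [hj] at h1
  refine eq_of_mul_eq (h.mem u hu) ?_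
  simp only [mul_add, mul_sub, mul_smul_comm, ← mul_assoc] at h1 ⊢
  linear_combination (norm := module) (-1 : ℝ) • h1

end

end IsFramedSurface

/-! ### Structure equations of the frame and their integrability conditions. -/

lemma lie_jAlg (ξ : E) : ξ * jAlg ξ - jAlg ξ * ξ = (-(2 * (1 / √3)) : ℝ) • (nrm ξ, nrm ξ) := by
  ext1
  · simp only [nrm, jAlg_fst, Prod.fst_sub, Prod.fst_mul, Prod.smul_fst,
      mul_sub, sub_mul, smul_mul_assoc, mul_smul_comm]
    module
  · simp only [nrm, jAlg_snd, Prod.snd_sub, Prod.snd_mul, Prod.smul_snd,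
      mul_sub, sub_mul, smul_mul_assoc, mul_smul_comm]
    module

/-- The bracket with both factors varied. -/
def nrmDeriv (ξ η : E) : Mat := (η.1 * ξ.2 - ξ.2 * η.1) + (ξ.1 * η.2 - η.2 * ξ.1)

lemma exists_hasFDerivAt_lie {V R : Type*} [NormedAddCommGroup V] [NormedSpace ℝ V] [NormedRing R]
    [NormedAlgebra ℝ R] {α β : V → R} {α' β' : V →L[ℝ] R} {u : V} (hα : HasFDerivAt α α' u)
    (hβ : HasFDerivAt β β' u) :
    ∃ L : V →L[ℝ] R, HasFDerivAt (fun x => α x * β x - β x * α x) L u ∧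
      ∀ v, L v = (α' v * β u - β u * α' v) + (α u * β' v - β' v * α u) := by
  refine ⟨_, (hα.mul' hβ).sub (hβ.mul' hα), fun v => ?_⟩
  simp only [sub_apply, add_apply, smul_apply, smul_eq_mul, MulOpposite.smul_eq_mul_unop,
    MulOpposite.unop_op]
  abel

lemma exists_hasFDerivAt_smul {V R : Type*} [NormedAddCommGroup V] [NormedSpace ℝ V]
    [NormedAddCommGroup R] [NormedSpace ℝ R] {c : V → ℝ} {α : V → R} {c' : V →L[ℝ] ℝ}
    {u : V} {N : V → R} (hc : HasFDerivAt c c' u)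
    (hα : ∃ α' : V →L[ℝ] R, HasFDerivAt α α' u ∧ ∀ v, α' v = N v) :
    ∃ L : V →L[ℝ] R, HasFDerivAt (fun x => c x • α x) L u ∧ ∀ v, L v = c u • N v + c' v • α u := by
  obtain ⟨α', hα, hN⟩ := hα
  exact ⟨_, hc.smul hα, fun v => by rw [← hN]; rfl⟩

lemma hasFDerivAt_nrm {V : Type*} [NormedAddCommGroup V] [NormedSpace ℝ V] {ξ : V → E}
    {ξ' : V →L[ℝ] E} {u : V} (h : HasFDerivAt ξ ξ' u) :
    ∃ L : V →L[ℝ] Mat, HasFDerivAt (fun x => nrm (ξ x)) L u ∧ ∀ v, L v = nrmDeriv (ξ u) (ξ' v) :=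
  exists_hasFDerivAt_lie h.fst h.snd

/-- When the frame moves in the direction of `n`, the bracket `n` moves in the span of `α` and `β`.
The integrability condition therefore splits into its `n` part and its part in that span. -/
lemma IsFrame.nrmDeriv_smul {ξ : E} (h : IsFrame ξ) (a b : ℝ) :
    nrmDeriv ξ (a • nrm ξ, b • nrm ξ) =
      a • ((2 : ℝ) • ξ.1 - (4 : ℝ) • ξ.2) - b • ((4 : ℝ) • ξ.1 - (2 : ℝ) • ξ.2) := by
  rw [← h.nrm_fst, ← h.nrm_snd, nrmDeriv]
  simp only [smul_mul_assoc, mul_smul_comm, smul_sub]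
  abel

lemma contDiffOn_nrm {V : Type*} [NormedAddCommGroup V] [NormedSpace ℝ V] {ξ : V → E} {W : Set V}
    (h : ContDiffOn ℝ ∞ ξ W) :
    ContDiffOn ℝ ∞ (fun x => nrm (ξ x)) W := by
  have h1 : ContDiffOn ℝ ∞ (fun x => (ξ x).1) W := contDiff_fst.comp_contDiffOn h
  have h2 : ContDiffOn ℝ ∞ (fun x => (ξ x).2) W := contDiff_snd.comp_contDiffOn h
  exact (h1.mul h2).sub (h2.mul h1)

namespace IsFramedSurface

variable {W : Set Plane} {f : Plane → E} {X Y : Plane → Plane} {ξ : Plane → E}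

section
variable (h : IsFramedSurface W f X Y ξ) {u : Plane} (hu : u ∈ W)
include h hu

/-- The fields `X` and `Y` commute, and the derivatives of the frame are orthogonal to it. -/
lemma structure_aux : fderiv ℝ Y u (X u) - fderiv ℝ X u (Y u) = 0 ∧
    inner4 (fderiv ℝ ξ u (X u)).1 (ξ u).2 = 0 := by
  obtain ⟨p, q, hpq⟩ := h.comb hu (fderiv ℝ Y u (X u) - fderiv ℝ X u (Y u))
  have e := h.fderiv_frame_commutator hu hpq
  rw [lie_jAlg] at e
  have hs : (1 / √3 : ℝ) ≠ 0 := by positivity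
  have hF := h.frame u hu
  have n1 : inner4 (nrm (ξ u)) (ξ u).1 = 0 := inner4_lie_left
  have n2 : inner4 (nrm (ξ u)) (ξ u).2 = 0 := inner4_lie_right
  have x1 := h.inner4_fst hu (X u)
  have x2 := h.inner4_snd hu (X u)
  have x3 := h.inner4_fst_snd hu (X u)
  have y1 := h.inner4_fst hu (Y u)
  have y2 := h.inner4_snd hu (Y u)
  have y3 := h.inner4_fst_snd hu (Y u)
  rw [e] at y1 y2 y3
  simp only [Prod.fst_sub, Prod.snd_sub, Prod.fst_add, Prod.snd_add, Prod.smul_fst, Prod.smul_snd,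
    jAlg_fst, jAlg_snd, inner4_sub_left, inner4_add_left, inner4_smul_left, n1, n2, x1, x2, x3,
    hF.fst, hF.snd, hF.fst_snd, inner4_comm (ξ u).2 (ξ u).1] at y1 y2 y3
  generalize (1 / √3 : ℝ) = s at hs y1 y2 y3
  -- What remains are three linear equations in `p`, `q` and `m = ⟨dα(X), β⟩`, with only the trivial
  -- solution: `y1 - y2` isolates `q`, then `y1` and `y3` kill `m` and `p`. The inhomogeneous term
  -- `[ξ, Jξ]` has dropped out because it is a multiple of `n`.
  generalize inner4 (fderiv ℝ ξ u (X u)).1 (ξ u).2 = m at y1 y2 y3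
  have hq : q = 0 := by
    have : s * q = 0 := by linear_combination (1 / 3) * y1 - (1 / 3) * y2
    exact (mul_eq_zero.1 this).resolve_left hs
  subst hq
  have hm : m = 0 := by
    have : s * m = 0 := by linear_combination (2 / 3) * y1 - (1 / 6) * y3
    exact (mul_eq_zero.1 this).resolve_left hs
  subst hm
  have hp : p = 0 := by linear_combination (-2) * y1
  subst hp
  exact ⟨by simpa using hpq, rfl⟩

/-- Both components of the derivative are orthogonal to `α` and `β`, which leaves only the direction
of `n`. -/
lemma fderiv_frame_X :
    fderiv ℝ ξ u (X u) = (coeffA ξ X u • nrm (ξ u), coeffB ξ X u • nrm (ξ u)) := by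
  have hm := (h.structure_aux hu).2
  have ht := h.traceless hu (X u)
  ext1
  · exact (h.frame u hu).eq_smul_nrm ht.1 (h.inner4_fst hu _) hm
  · exact (h.frame u hu).eq_smul_nrm ht.2 (by rw [h.inner4_fst_snd hu, hm, neg_zero])
      (h.inner4_snd hu _)

lemma fderiv_frame_Y : fderiv ℝ ξ u (Y u) =
    ((1 / √3 * (coeffA ξ X u - 2 * coeffB ξ X u - 2)) • nrm (ξ u),
      (1 / √3 * (2 * coeffA ξ X u - coeffB ξ X u - 2)) • nrm (ξ u)) := by
  have e := h.fderiv_frame_commutator (p := 0) (q := 0) hu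
    (by rw [(h.structure_aux hu).1]; simp)
  rw [e, lie_jAlg, h.fderiv_frame_X hu]
  ext1
  · simp only [Prod.fst_sub, Prod.fst_add, Prod.smul_fst, jAlg_fst]; module
  · simp only [Prod.snd_sub, Prod.snd_add, Prod.smul_snd, jAlg_snd]; module

end

lemma contDiffOn_coeffA (h : IsFramedSurface W f X Y ξ) : ContDiffOn ℝ ∞ (coeffA ξ X) W := by
  have h1 : ContDiffOn ℝ ∞ (fun u => fderiv ℝ ξ u (X u)) W :=
    (h.smoothξ.fderiv_of_isOpen h.isOpen (by simp)).clm_apply h.smoothX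
  exact contDiffOn_const.mul
    (ContDiffOn.inner4 (contDiff_fst.comp_contDiffOn h1) (contDiffOn_nrm h.smoothξ))

lemma contDiffOn_coeffB (h : IsFramedSurface W f X Y ξ) : ContDiffOn ℝ ∞ (coeffB ξ X) W := by
  have h1 : ContDiffOn ℝ ∞ (fun u => fderiv ℝ ξ u (X u)) W :=
    (h.smoothξ.fderiv_of_isOpen h.isOpen (by simp)).clm_apply h.smoothX
  exact contDiffOn_const.mul
    (ContDiffOn.inner4 (contDiff_snd.comp_contDiffOn h1) (contDiffOn_nrm h.smoothξ))

section
variable (h : IsFramedSurface W f X Y ξ) {u : Plane} (hu : u ∈ W)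
include h hu

/-- The integrability conditions of the frame equations. -/
lemma compatibility :
    (coeffA ξ X u ^ 2 - coeffA ξ X u * coeffB ξ X u + coeffB ξ X u ^ 2 - coeffA ξ X u +
      coeffB ξ X u = 0) ∧
    1 / √3 * (fderiv ℝ (coeffA ξ X) u (X u) - 2 * fderiv ℝ (coeffB ξ X) u (X u)) =
      fderiv ℝ (coeffA ξ X) u (Y u) ∧
    1 / √3 * (2 * fderiv ℝ (coeffA ξ X) u (X u) - fderiv ℝ (coeffB ξ X) u (X u)) =
      fderiv ℝ (coeffB ξ X) u (Y u) := by
  have hW := h.isOpen.mem_nhds hu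
  have hF := h.frame u hu
  have hX := (h.smoothX.contDiffAt hW).differentiableAt (by simp)
  have hY := (h.smoothY.contDiffAt hW).differentiableAt (by simp)
  have hA := ((h.contDiffOn_coeffA.contDiffAt hW).differentiableAt (by simp)).hasFDerivAt
  have hB := ((h.contDiffOn_coeffB.contDiffAt hW).differentiableAt (by simp)).hasFDerivAt
  have hN := hasFDerivAt_nrm (h.hasFDerivAt_frame hu)
  have h1 := fderiv_fderiv_apply_sub (h.smoothξ.contDiffAt hW) hX hY
  have eX : (fun x => fderiv ℝ ξ x (X x)) =ᶠ[𝓝 u] _ :=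
    Filter.mem_of_superset hW fun x hx => h.fderiv_frame_X hx
  have eY : (fun x => fderiv ℝ ξ x (Y x)) =ᶠ[𝓝 u] _ :=
    Filter.mem_of_superset hW fun x hx => h.fderiv_frame_Y hx
  have hA' : HasFDerivAt (fun x => 1 / √3 * (coeffA ξ X x - 2 * coeffB ξ X x - 2)) _ u :=
    ((hA.sub (hB.const_mul 2)).sub_const 2).const_mul (1 / √3)
  have hB' : HasFDerivAt (fun x => 1 / √3 * (2 * coeffA ξ X x - coeffB ξ X x - 2)) _ u :=
    (((hA.const_mul 2).sub hB).sub_const 2).const_mul (1 / √3)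
  obtain ⟨L1, l1, l1'⟩ := exists_hasFDerivAt_smul hA hN
  obtain ⟨L2, l2, l2'⟩ := exists_hasFDerivAt_smul hB hN
  obtain ⟨L3, l3, l3'⟩ := exists_hasFDerivAt_smul hA' hN
  obtain ⟨L4, l4, l4'⟩ := exists_hasFDerivAt_smul hB' hN
  have dX := l1.prodMk l2
  have dY := l3.prodMk l4
  have fX := (dX.congr_of_eventuallyEq eX).fderiv
  have fY := (dY.congr_of_eventuallyEq eY).fderiv
  rw [fX, fY, (h.structure_aux hu).1, map_zero] at h1
  simp only [ContinuousLinearMap.prod_apply, smul_apply, sub_apply,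
    l1', l2', l3', l4', h.fderiv_frame_X hu, h.fderiv_frame_Y hu,
    hF.nrmDeriv_smul, smul_eq_mul] at h1
  have n2 : inner4 (nrm (ξ u)) (ξ u).2 = 0 := inner4_lie_right
  have n1' : inner4 (ξ u).1 (nrm (ξ u)) = 0 := by rw [inner4_comm]; exact inner4_lie_left
  have n2' : inner4 (ξ u).2 (nrm (ξ u)) = 0 := by rw [inner4_comm, n2]
  have c1 := congrArg Prod.fst h1
  have c2 := congrArg Prod.snd h1
  -- Pairing with `n` keeps only the derivatives of the coefficients. Pairing the first component
  -- with `β` yields the conic: `[n, β] = 2α - 4β` is orthogonal to `β`, so only the terms with `[n,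
  -- α]` survive.
  have k1 := congrArg (inner4 · (nrm (ξ u))) c1
  have k2 := congrArg (inner4 · (nrm (ξ u))) c2
  have k3 := congrArg (inner4 · (ξ u).2) c1
  have hs := inv_sqrt_three_mul_self
  have hs0 : (1 / √3 : ℝ) ≠ 0 := by positivity
  simp only [Prod.fst_sub, Prod.snd_sub, Prod.fst_zero, Prod.snd_zero,
    inner4_zero_left, inner4_sub_left, inner4_add_left,
    inner4_smul_left, n2, n1', n2', hF.nrm_nrm, hF.snd, hF.fst_snd] at k1 k2 k3
  generalize (1 / √3 : ℝ) = s at *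
  refine ⟨?_, ?_, ?_⟩
  · refine (mul_eq_zero.1 (?_ : s * _ = 0)).resolve_left hs0
    linear_combination (1 / 6) * k3
  · linear_combination (1 / 3) * k1
  · linear_combination (1 / 3) * k2

/-- The coefficients of the frame equations are locally constant. -/
lemma fderiv_coeff_eq_zero : fderiv ℝ (coeffA ξ X) u = 0 ∧ fderiv ℝ (coeffB ξ X) u = 0 := by
  have hW := h.isOpen.mem_nhds hu
  obtain ⟨e0, e1, e2⟩ := h.compatibility hu
  have hA := ((h.contDiffOn_coeffA.contDiffAt hW).differentiableAt (by simp)).hasFDerivAt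
  have hB := ((h.contDiffOn_coeffB.contDiffAt hW).differentiableAt (by simp)).hasFDerivAt
  have hQ := ((((hA.mul hA).sub (hA.mul hB)).add (hB.mul hB)).sub hA).add hB
  have hQ0 := hQ.unique ((hasFDerivAt_const (0 : ℝ) u).congr_of_eventuallyEq
    (Filter.mem_of_superset hW fun x hx => by
      have := (h.compatibility hx).1
      simp only [Set.mem_ofPred_eq, Pi.add_apply, Pi.sub_apply, Pi.mul_apply]
      linarith))
  have qX := congrArg (fun l => l (X u)) hQ0
  have qY := congrArg (fun l => l (Y u)) hQ0
  simp only [add_apply, sub_apply, smul_apply, smul_eq_mul, zero_apply] at qX qY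
  rw [← e1, ← e2] at qY
  have hs0 : (1 / √3 : ℝ) ≠ 0 := by positivity
  have hY1 := e1
  have hY2 := e2
  generalize (1 / √3 : ℝ) = s at *
  set a := coeffA ξ X u
  set b := coeffB ξ X u
  set x := fderiv ℝ (coeffA ξ X) u (X u) with hx
  set y := fderiv ℝ (coeffB ξ X) u (X u) with hy
  have qY' : (2 * a - b - 1) * (x - 2 * y) + (2 * b - a + 1) * (2 * x - y) = 0 := by
    refine (mul_eq_zero.1 (?_ : s * _ = 0)).resolve_left hs0
    linear_combination qY
  -- Cramer's rule for `qX`, `qY'` as a linear system in `x`, `y`. With `k = 2a - b - 1` and `l = 2b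
  -- - a + 1` its determinant is `-2 (k² + kl + l²)`, which equals `-2` on the conic; the multiple
  -- of `e0` accounts for this.
  have hx0 : x = 0 := by 
    linear_combination (1 / 2 * (3 * a - 1)) * qX + (1 / 2 * (2 * b - a + 1)) * qY' - 3 * x * e0
  have hy0 : y = 0 := by
    linear_combination (1 / 2 * (3 * b + 1)) * qX - (1 / 2 * (2 * a - b - 1)) * qY' - 3 * y * e0
  have key : ∀ L : Plane →L[ℝ] ℝ, L (X u) = 0 → L (Y u) = 0 → L = 0 := by
    intro L h1 h2
    ext v
    obtain ⟨p, q, rfl⟩ := h.comb hu v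
    simp [h1, h2]
  refine ⟨key _ hx0 ?_, key _ hy0 ?_⟩
  · rw [← e1, hx0, hy0]; ring
  · rw [← e2, hx0, hy0]; ring

end

end IsFramedSurface

/-! ### Uniqueness of integral surfaces of a distribution -/

section Integral

variable {V : Type*} [NormedAddCommGroup V] [NormedSpace ℝ V]

/-- An integral surface of the distribution `D` is locally a graph. -/
lemma exists_graph_chart {W : Set Plane} {f : Plane → V} {D : V → Plane →L[ℝ] V}
    {A : Plane → Plane →L[ℝ] Plane} (hW : IsOpen W) (hf : ContDiffOn ℝ ∞ f W)
    (hD : Continuous D) (hDA : ∀ u ∈ W, D (f u) = fderiv ℝ f u ∘L A u) {u₀ : Plane} (hu₀ : u₀ ∈ W)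
    (π : V →L[ℝ] Plane) (hπ : π ∘L D (f u₀) = ContinuousLinearMap.id ℝ Plane) :
    ∃ h : OpenPartialHomeomorph Plane Plane, u₀ ∈ h.source ∧ h.source ⊆ W ∧
      (∀ u, h u = π (f u)) ∧ ContDiffOn ℝ ∞ h h.source ∧
      ContDiffOn ℝ ∞ h.symm h.target ∧ ∀ s ∈ h.target, HasFDerivAt (f ∘ h.symm)
        (D (f (h.symm s)) ∘L (π ∘L D (f (h.symm s))).inverse) s := by
  set W' : Set Plane := W ∩ (fun u => π ∘L D (f u)) ⁻¹'
    (Set.range ((↑) : (Plane ≃L[ℝ] Plane) → Plane →L[ℝ] Plane)) with hW'def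
  have hW' : IsOpen W' := by
    refine ContinuousOn.isOpen_inter_preimage ?_ hW (ContinuousLinearEquiv.isOpen)
    exact continuousOn_const.clm_comp (hD.comp_continuousOn hf.continuousOn)
  have hsub : W' ⊆ W := Set.inter_subset_left
  have hu₀' : u₀ ∈ W' := ⟨hu₀, ContinuousLinearEquiv.refl ℝ Plane, hπ.symm⟩
  have hfd : ∀ u ∈ W', HasFDerivAt f (fderiv ℝ f u) u := fun u hu =>
    ((hf.contDiffAt (hW.mem_nhds (hsub hu))).differentiableAt (by simp)).hasFDerivAt
  have key : ∀ u ∈ W', ∃ e : Plane ≃L[ℝ] Plane, HasFDerivAt (fun x => π (f x))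
      (e : Plane →L[ℝ] Plane) u ∧ fderiv ℝ f u ∘L (e.symm : Plane →L[ℝ] Plane) =
        D (f u) ∘L (π ∘L D (f u)).inverse := by
    intro u hu
    obtain ⟨e', he'⟩ := hu.2
    replace he' : (e' : Plane →L[ℝ] Plane) = π ∘L D (f u) := he'
    have hDAu := hDA u (hsub hu)
    set L : Plane →L[ℝ] Plane := π ∘L fderiv ℝ f u with hL
    set R : Plane →L[ℝ] Plane := A u ∘L (e'.symm : Plane →L[ℝ] Plane) with hR
    -- The range of `D (f u)` lies in that of the derivative of `f`. Hence invertibility of `π ∘ D`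
    -- makes `π ∘ df` surjective, so invertible on the plane, and `π ∘ f` is a local diffeomorphism.
    have he'' : (e' : Plane →L[ℝ] Plane) = L ∘L A u := by
      rw [he', hL, ContinuousLinearMap.comp_assoc, ← hDA u (hsub hu)]
    have h1 : L ∘L R = ContinuousLinearMap.id ℝ Plane := by
      rw [hR, ← ContinuousLinearMap.comp_assoc, ← he'']
      ext v; simp
    have h2 : R.toLinearMap * L.toLinearMap = 1 := by
      refine mul_eq_one_symm ?_
      exact congrArg ContinuousLinearMap.toLinearMap h1
    refine ⟨ContinuousLinearEquiv.equivOfInverse L R (fun x => congrArg (fun l => l x) h2)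
      (fun x => congrArg (fun l => l x) h1), ?_, ?_⟩
    · exact π.hasFDerivAt.comp u (hfd u hu)
    · have h3 : (π ∘L D (f u)).inverse = (e'.symm : Plane →L[ℝ] Plane) := by
        rw [← he', ContinuousLinearMap.inverse_equiv]
      rw [h3, hDAu]
      rfl
  have hh : ∀ u ∈ W', ContDiffAt ℝ ∞ (fun x => π (f x)) u := fun u hu =>
    π.contDiff.contDiffAt.comp u (hf.contDiffAt (hW.mem_nhds (hsub hu)))
  obtain ⟨e₀, he₀, -⟩ := key u₀ hu₀'
  let h₀ := (hh u₀ hu₀').toOpenPartialHomeomorph (fun x => π (f x)) he₀ (by simp)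
  have hh₀ : (h₀ : Plane → Plane) = fun x => π (f x) := rfl
  let h := h₀.restrOpen W' hW'
  have hs : ∀ s ∈ h.target, h.symm s ∈ W' := fun s hs => (h.map_target hs).2
  have hsymm : ∀ s ∈ h.target, ContDiffAt ℝ ∞ h.symm s := by
    intro s hs'
    obtain ⟨e, he, -⟩ := key _ (hs s hs')
    exact h.contDiffAt_symm hs' he (hh _ (hs s hs'))
  refine ⟨h, ⟨(hh u₀ hu₀').mem_toOpenPartialHomeomorph_source he₀ (by simp), hu₀'⟩,
    fun x hx => hsub hx.2, fun _ => rfl, fun x hx => (hh x hx.2).contDiffWithinAt,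
    fun s hs' => (hsymm s hs').contDiffWithinAt, ?_⟩
  intro s hs'
  obtain ⟨e, he, he'⟩ := key _ (hs s hs')
  rw [← he']
  exact (hfd _ (hs s hs')).comp s (h.hasFDerivAt_symm hs' he)

/-- Two integral surfaces of a distribution through the same point coincide locally. -/
theorem exists_openPartialHomeomorph_of_integral [FiniteDimensional ℝ V] {W₁ W₂ : Set Plane}
    {f₁ f₂ : Plane → V} {D : V → Plane →L[ℝ] V} {A₁ A₂ : Plane → Plane →L[ℝ] Plane}
    (hW₁ : IsOpen W₁) (hW₂ : IsOpen W₂) (hf₁ : ContDiffOn ℝ ∞ f₁ W₁) (hf₂ : ContDiffOn ℝ ∞ f₂ W₂)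
    (hD : ContDiff ℝ ∞ D) (hDA₁ : ∀ u ∈ W₁, D (f₁ u) = fderiv ℝ f₁ u ∘L A₁ u)
    (hDA₂ : ∀ u ∈ W₂, D (f₂ u) = fderiv ℝ f₂ u ∘L A₂ u) {u₁ u₂ : Plane} (hu₁ : u₁ ∈ W₁)
    (hu₂ : u₂ ∈ W₂) (h12 : f₁ u₁ = f₂ u₂) (hinj : Function.Injective (D (f₁ u₁))) :
    ∃ τ : OpenPartialHomeomorph Plane Plane, u₁ ∈ τ.source ∧ τ u₁ = u₂ ∧ τ.source ⊆ W₁ ∧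
      τ.target ⊆ W₂ ∧ ContDiffOn ℝ ∞ τ τ.source ∧ ContDiffOn ℝ ∞ τ.symm τ.target ∧
      ∀ u ∈ τ.source, f₁ u = f₂ (τ u) := by
  obtain ⟨π₀, hπ₀⟩ := (D (f₁ u₁)).toLinearMap.exists_leftInverse_of_injective
    (LinearMap.ker_eq_bot.2 hinj)
  set π : V →L[ℝ] Plane := π₀.toContinuousLinearMap
  have hπ : π ∘L D (f₁ u₁) = ContinuousLinearMap.id ℝ Plane := by
    ext1 v; exact congrArg (fun l => l v) hπ₀
  obtain ⟨h₁, m₁, s₁, e₁, c₁, c₁', d₁⟩ := exists_graph_chart hW₁ hf₁ hD.continuous hDA₁ hu₁ π hπ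
  obtain ⟨h₂, m₂, s₂, e₂, c₂, c₂', d₂⟩ :=
    exists_graph_chart hW₂ hf₂ hD.continuous hDA₂ hu₂ π (h12 ▸ hπ)
  -- Parametrised by `s = π (f u)`, both surfaces solve the same equation `dk/ds = H(k)`; neither
  -- `A₁` nor `A₂` enters it.
  set H : V → Plane →L[ℝ] V := fun w => D w ∘L (π ∘L D w).inverse with hH
  have hHc : ContDiffAt ℝ 1 H (f₁ u₁) := by
    refine (ContDiffAt.of_le (n := ∞) ?_ ENat.LEInfty.out)
    refine hD.contDiffAt.clm_comp ?_
    refine ContDiffAt.comp (g := ContinuousLinearMap.inverse) (f₁ u₁) ?_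
      (contDiffAt_const.clm_comp hD.contDiffAt)
    rw [hπ]
    exact contDiffAt_map_inverse (ContinuousLinearEquiv.refl ℝ Plane)
  obtain ⟨K, t, ht, hK⟩ := hHc.exists_lipschitzOnWith
  set c := π (f₁ u₁) with hc
  have hc1 : h₁ u₁ = c := e₁ u₁
  have hc2 : h₂ u₂ = c := by rw [e₂, ← h12]
  have ct1 : c ∈ h₁.target := hc1 ▸ h₁.map_source m₁
  have ct2 : c ∈ h₂.target := hc2 ▸ h₂.map_source m₂
  have k1c : f₁ (h₁.symm c) = f₁ u₁ := by rw [← hc1, h₁.left_inv m₁]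
  have k2c : f₂ (h₂.symm c) = f₁ u₁ := by rw [← hc2, h₂.left_inv m₂, h12]
  have n1 : ∀ᶠ s in 𝓝 c, f₁ (h₁.symm s) ∈ t :=
    (d₁ c ct1).continuousAt.eventually_mem (by rw [Function.comp_apply, k1c]; exact ht)
  have n2 : ∀ᶠ s in 𝓝 c, f₂ (h₂.symm s) ∈ t :=
    (d₂ c ct2).continuousAt.eventually_mem (by rw [Function.comp_apply, k2c]; exact ht)
  obtain ⟨ε, hε, hball⟩ := Metric.eventually_nhds_iff_ball.1
    (((h₁.open_target.eventually_mem ct1).and (h₂.open_target.eventually_mem ct2)).and (n1.and n2))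
  have heq : ∀ s ∈ Metric.ball c ε, f₁ (h₁.symm s) = f₂ (h₂.symm s) := by
    -- Restricted to the segment from `c` to `s`, the equation becomes an ordinary differential
    -- equation with Lipschitz right-hand side and common initial value. Uniqueness suffices, so no
    -- integrability of the distribution is needed.
    intro s hs
    have hseg : ∀ r ∈ Set.Icc (0 : ℝ) 1, c + r • (s - c) ∈ Metric.ball c ε := by
      intro r hr
      rw [Metric.mem_ball, dist_eq_norm] at hs ⊢
      rw [add_sub_cancel_left, norm_smul, Real.norm_of_nonneg hr.1]
      exact lt_of_le_of_lt (mul_le_of_le_one_left (norm_nonneg _) hr.2) hs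
    have hline : ∀ r : ℝ, HasDerivAt (fun r : ℝ => c + r • (s - c)) (s - c) r := by
      intro r
      simpa using ((hasDerivAt_id r).smul_const (s - c)).const_add c
    have g1 : ∀ r ∈ Set.Icc (0 : ℝ) 1, HasDerivAt (fun r : ℝ => f₁ (h₁.symm (c + r • (s - c))))
        (H (f₁ (h₁.symm (c + r • (s - c)))) (s - c)) r := fun r hr =>
      HasFDerivAt.comp_hasDerivAt (l := f₁ ∘ h₁.symm) (f := fun r : ℝ => c + r • (s - c)) r
        (d₁ _ (hball _ (hseg r hr)).1.1) (hline r)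
    have g2 : ∀ r ∈ Set.Icc (0 : ℝ) 1, HasDerivAt (fun r : ℝ => f₂ (h₂.symm (c + r • (s - c))))
        (H (f₂ (h₂.symm (c + r • (s - c)))) (s - c)) r := fun r hr =>
      HasFDerivAt.comp_hasDerivAt (l := f₂ ∘ h₂.symm) (f := fun r : ℝ => c + r • (s - c)) r
        (d₂ _ (hball _ (hseg r hr)).1.2) (hline r)
    have hL : LipschitzOnWith (K * ‖s - c‖₊) (fun w => H w (s - c)) t := by
      refine LipschitzOnWith.of_dist_le_mul fun x hx y hy => ?_
      have h1 := hK.dist_le_mul x hx y hy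
      rw [dist_eq_norm] at h1 ⊢
      rw [← sub_apply]
      calc ‖(H x - H y) (s - c)‖ ≤ ‖H x - H y‖ * ‖s - c‖ := ContinuousLinearMap.le_opNorm _ _
        _ ≤ (K * dist x y) * ‖s - c‖ := by gcongr
        _ = _ := by push_cast; ring
    have hu := ODE_solution_unique_of_mem_Icc_right (v := fun _ w => H w (s - c))
      (s := fun _ => t) (K := K * ‖s - c‖₊) (a := 0) (b := 1) (fun _ _ => hL)
      (f := fun r : ℝ => f₁ (h₁.symm (c + r • (s - c))))
      (g := fun r : ℝ => f₂ (h₂.symm (c + r • (s - c))))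
      (fun r hr => (g1 r hr).continuousAt.continuousWithinAt)
      (fun r hr => (g1 r (Set.Ico_subset_Icc_self hr)).hasDerivWithinAt)
      (fun r hr => (hball _ (hseg r (Set.Ico_subset_Icc_self hr))).2.1)
      (fun r hr => (g2 r hr).continuousAt.continuousWithinAt)
      (fun r hr => (g2 r (Set.Ico_subset_Icc_self hr)).hasDerivWithinAt)
      (fun r hr => (hball _ (hseg r (Set.Ico_subset_Icc_self hr))).2.2)
      (by simp [k1c, k2c]) (Set.right_mem_Icc.2 zero_le_one)
    simpa using hu
  -- Points with the same `π`-coordinate correspond.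
  let τ := (h₁ ≫ₕ OpenPartialHomeomorph.ofSet (Metric.ball c ε) Metric.isOpen_ball) ≫ₕ h₂.symm
  have hτ : ∀ u, τ u = h₂.symm (h₁ u) := fun _ => rfl
  have hτs : ∀ u, τ.symm u = h₁.symm (h₂ u) := fun _ => rfl
  have src : ∀ u ∈ τ.source, u ∈ h₁.source ∧ h₁ u ∈ Metric.ball c ε ∧ h₁ u ∈ h₂.target := by
    intro u hu
    exact ⟨hu.1.1, hu.1.2, hu.2⟩
  have tgt : ∀ u ∈ τ.target, u ∈ h₂.source ∧ h₂ u ∈ Metric.ball c ε ∧ h₂ u ∈ h₁.target := by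
    intro u hu
    exact ⟨hu.1, hu.2.1, hu.2.2⟩
  refine ⟨τ, ⟨⟨m₁, ?_⟩, ?_⟩, ?_, fun u hu => s₁ (src u hu).1, fun u hu => s₂ (tgt u hu).1, ?_, ?_, ?_⟩
  · change h₁ u₁ ∈ Metric.ball c ε
    rw [hc1]; exact Metric.mem_ball_self hε
  · change h₁ u₁ ∈ h₂.target
    rw [hc1]; exact ct2
  · rw [hτ, hc1, ← hc2, h₂.left_inv m₂]
  · exact c₂'.comp (c₁.mono fun u hu => (src u hu).1) fun u hu => (src u hu).2.2
  · exact c₁'.comp (c₂.mono fun u hu => (tgt u hu).1) fun u hu => (tgt u hu).2.2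
  · intro u hu
    rw [hτ, ← heq _ (src u hu).2.1, h₁.left_inv (src u hu).1]

end Integral

/-! ### Congruence of frames -/

lemma Mat.det_mul (x y : Mat) : (x * y).det = x.det * y.det :=
  Matrix.det_mul (x : Matrix (Fin 2) (Fin 2) ℝ) y

lemma Mat.det_one : (1 : Mat).det = 1 := Matrix.det_one (n := Fin 2) (R := ℝ)

lemma Mat.inv_mul_of_ne_zero {A : Mat} (hA : A.det ≠ 0) : A⁻¹ * A = 1 :=
  Matrix.nonsing_inv_mul (A : Matrix (Fin 2) (Fin 2) ℝ) hA.isUnit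

lemma Mat.mul_inv_of_ne_zero {A : Mat} (hA : A.det ≠ 0) : A * A⁻¹ = 1 :=
  Matrix.mul_nonsing_inv (A : Matrix (Fin 2) (Fin 2) ℝ) hA.isUnit

/-- The `2 × 2` matrix with the given entries. -/
def Mat.mk (a b c d : ℝ) : Mat := (!![a, b; c, d] : Matrix (Fin 2) (Fin 2) ℝ)

lemma Mat.mk_zero_zero (a b c d : ℝ) : Mat.mk a b c d 0 0 = a := rfl
lemma Mat.mk_zero_one (a b c d : ℝ) : Mat.mk a b c d 0 1 = b := rfl
lemma Mat.mk_one_zero (a b c d : ℝ) : Mat.mk a b c d 1 0 = c := rfl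
lemma Mat.mk_one_one (a b c d : ℝ) : Mat.mk a b c d 1 1 = d := rfl

/-- A frame is conjugate to a standard one. -/
lemma IsFrame.exists_normal_form {ξ : E} (h : IsFrame ξ) : ∃ Q : Mat, Q.det ≠ 0 ∧
    ξ.1 * Q = Q * Mat.mk (1 / √2) 0 0 (-(1 / √2)) ∧
    ξ.2 * Q = Q * Mat.mk (2 * (1 / √2)) (-(3 / 2)) 1 (-(2 * (1 / √2))) := by
  have hr : (1 / √2 : ℝ) * (1 / √2) = 1 / 2 := by
    rw [div_mul_div_comm, Real.mul_self_sqrt (by norm_num)]; norm_num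
  have hr0 : (1 / √2 : ℝ) ≠ 0 := by positivity
  generalize (1 / √2 : ℝ) = r at *
  have t1 := Mat.apply_one_one h.traceless.1
  have t2 := Mat.apply_one_one h.traceless.2
  have a1 := h.fst
  have a2 := h.snd
  have a3 := h.fst_snd
  simp only [inner4, t1, t2] at a1 a2 a3
  set x := ξ.1 0 0
  set y := ξ.1 0 1
  set z := ξ.1 1 0
  set x' := ξ.2 0 0
  set y' := ξ.2 0 1
  set z' := ξ.2 1 0
  -- An eigenvector of `α` for the eigenvalue `r`. Since `α² = r²`, every nonzero column of `α + r`
  -- is one: the first column in general, the second when the first vanishes.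
  obtain ⟨v, w, hvw, e1, e2⟩ : ∃ v w : ℝ, (v ≠ 0 ∨ w ≠ 0) ∧ x * v + y * w = r * v ∧
      z * v - x * w = r * w := by
    by_cases hz : z = 0
    · by_cases hx : x + r = 0
      · refine ⟨y, 2 * r, Or.inr (by simpa using hr0), ?_, ?_⟩
        · linear_combination y * hx
        · linear_combination y * hz - 2 * r * hx
      · refine ⟨x + r, z, Or.inl hx, ?_, ?_⟩
        · linear_combination a1 - hr
        · ring
    · refine ⟨x + r, z, Or.inr hz, ?_, ?_⟩
      · linear_combination a1 - hr
      · ring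
  -- The entries of `N = β - 2α`. It is orthogonal to `α`, hence anticommutes with it and maps the
  -- `r`-eigenvector to a `(-r)`-eigenvector; moreover `N² = -3/2`. In the basis `(v, w)`, `N (v,
  -- w)` the normal form can be read off.
  set p := x' - 2 * x with hp
  set q := y' - 2 * y with hq
  set m := z' - 2 * z with hm
  have hpq : p ^ 2 + q * m = -(3 / 2) := by
    rw [hp, hq, hm]; linear_combination a2 + 4 * a1 - 4 * a3
  have hs : 2 * x * p + y * m + q * z = 0 := by
    rw [hp, hq, hm]; linear_combination 2 * a3 - 4 * a1
  -- `N² = -3/2` excludes real eigenvectors of `N`, so `(v, w)` and `N (v, w)` are independent.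
  have hdet : v * (m * v - p * w) - (p * v + q * w) * w ≠ 0 := by
    intro h0
    have h1 : (m * v - p * w) ^ 2 + 3 / 2 * w ^ 2 = 0 := by
      linear_combination m * h0 + w ^ 2 * hpq
    have hw : w = 0 := pow_eq_zero_iff two_ne_zero |>.1
      (by nlinarith [sq_nonneg (m * v - p * w), sq_nonneg w])
    have hm0 : m ≠ 0 := by
      intro hm0
      rw [hm0] at hpq
      nlinarith [sq_nonneg p]
    have hv : m * v = 0 := by
      have : (m * v - p * w) ^ 2 = 0 := by rw [hw] at h1 ⊢; linarith
      have := pow_eq_zero_iff two_ne_zero |>.1 this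
      rw [hw] at this; linarith
    have hv' := (mul_eq_zero.1 hv).resolve_left hm0
    rcases hvw with h | h
    · exact h hv'
    · exact h hw
  refine ⟨Mat.mk v (p * v + q * w) w (m * v - p * w), ?_, ?_, ?_⟩
  · rw [Mat.det_eq]
    exact hdet
  · refine Mat.ext fun i j => ?_
    fin_cases i <;> fin_cases j <;>
      simp only [Mat.mul_apply, Fin.zero_eta, Fin.mk_one, Fin.isValue, Mat.mk_zero_zero,
        Mat.mk_zero_one, Mat.mk_one_zero, Mat.mk_one_one, t1]
    · linear_combination e1
    · change x * (p * v + q * w) + y * (m * v - p * w) = v * 0 + (p * v + q * w) * -r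
      linear_combination v * hs - p * e1 - q * e2
    · linear_combination e2
    · change z * (p * v + q * w) + -x * (m * v - p * w) = w * 0 + (m * v - p * w) * -r
      linear_combination w * hs - m * e1 + p * e2
  · refine Mat.ext fun i j => ?_
    fin_cases i <;> fin_cases j <;>
      simp only [Mat.mul_apply, Fin.zero_eta, Fin.mk_one, Fin.isValue, Mat.mk_zero_zero,
        Mat.mk_zero_one, Mat.mk_one_zero, Mat.mk_one_one, t2]
    · change x' * v + y' * w = v * (2 * r) + (p * v + q * w) * 1
      linear_combination 2 * e1 - v * hp - w * hq
    · change x' * (p * v + q * w) + y' * (m * v - p * w) =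
        v * -(3 / 2) + (p * v + q * w) * -(2 * r)
      linear_combination v * hpq + 2 * (v * hs - p * e1 - q * e2) - (p * v + q * w) * hp -
        (m * v - p * w) * hq
    · change z' * v + -x' * w = w * (2 * r) + (m * v - p * w) * 1
      linear_combination 2 * e2 - v * hm + w * hp
    · change z' * (p * v + q * w) + -x' * (m * v - p * w) =
        w * -(3 / 2) + (m * v - p * w) * -(2 * r)
      linear_combination w * hpq + 2 * (w * hs - m * e1 + p * e2) - (p * v + q * w) * hm +
        (m * v - p * w) * hp

/-- Any two frames are conjugate. -/
lemma IsFrame.exists_conj {ξ η : E} (hξ : IsFrame ξ) (hη : IsFrame η) :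
    ∃ C D : Mat, C * D = 1 ∧ D * C = 1 ∧ (C, C) * ξ * (D, D) = η := by
  obtain ⟨Q, hQ, q1, q2⟩ := hξ.exists_normal_form
  obtain ⟨R, hR, r1, r2⟩ := hη.exists_normal_form
  have c1 := Mat.inv_mul_of_ne_zero hQ
  have c2 := Mat.mul_inv_of_ne_zero hQ
  have c3 := Mat.inv_mul_of_ne_zero hR
  have c4 := Mat.mul_inv_of_ne_zero hR
  have key : ∀ x y N : Mat, x * Q = Q * N → y * R = R * N → R * Q⁻¹ * x * (Q * R⁻¹) = y := by
    intro x y N h1 h2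
    calc R * Q⁻¹ * x * (Q * R⁻¹) = R * Q⁻¹ * (x * Q) * R⁻¹ := by noncomm_ring
      _ = R * (Q⁻¹ * Q) * N * R⁻¹ := by rw [h1]; noncomm_ring
      _ = y * (R * R⁻¹) := by rw [c1, mul_one, ← h2, mul_assoc]
      _ = y := by rw [c4, mul_one]
  refine ⟨R * Q⁻¹, Q * R⁻¹, ?_, ?_, Prod.ext (key _ _ _ q1 r1) (key _ _ _ q2 r2)⟩
  · calc R * Q⁻¹ * (Q * R⁻¹) = R * (Q⁻¹ * Q) * R⁻¹ := by noncomm_ring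
      _ = 1 := by rw [c1, mul_one, c4]
  · calc Q * R⁻¹ * (R * Q⁻¹) = Q * (R⁻¹ * R) * Q⁻¹ := by noncomm_ring
      _ = 1 := by rw [c3, mul_one, c2]

/-- `inner4` is minus the polarization of the determinant. Conjugation by any invertible matrix thus
preserves it, whatever the sign of the determinant. -/
lemma inner4_mul_left (C x y : Mat) : inner4 (C * x) (C * y) = C.det * inner4 x y := by
  simp only [inner4, Mat.mul_apply, Mat.det_eq]; ring

lemma inner4_mul_right (C x y : Mat) : inner4 (x * C) (y * C) = C.det * inner4 x y := by
  simp only [inner4, Mat.mul_apply, Mat.det_eq]; ring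

lemma det_mul_det_eq_one {C D : Mat} (h : C * D = 1) : C.det * D.det = 1 := by
  rw [← Mat.det_mul, h, Mat.det_one]

lemma inner4_conj {C D : Mat} (h : C * D = 1) (x y : Mat) :
    inner4 (C * x * D) (C * y * D) = inner4 x y := by
  rw [inner4_mul_right, inner4_mul_left, ← mul_assoc, mul_comm D.det, det_mul_det_eq_one h, one_mul]

lemma gAlg_conj {C D : Mat} (h : C * D = 1) (x y : E) :
    gAlg ((C, C) * x * (D, D)) ((C, C) * y * (D, D)) = gAlg x y := by
  simp only [gAlg_eq_inner4, Prod.fst_mul, Prod.snd_mul, inner4_conj h]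

/-- `z ↦ K z L`, as a continuous linear map. -/
def mulMul (K L : E) : E →L[ℝ] E :=
  ((LinearMap.mulLeft ℝ K) ∘ₗ (LinearMap.mulRight ℝ L)).toContinuousLinearMap

lemma mulMul_apply (K L z : E) : mulMul K L z = K * z * L := (mul_assoc _ _ _).symm

lemma mul_mem_SL2SL2 {K L z : E} (h1 : K.1.det * L.1.det = 1) (h2 : K.2.det * L.2.det = 1)
    (hz : z ∈ SL2SL2) : K * z * L ∈ SL2SL2 := by
  constructor
  · rw [Prod.fst_mul, Prod.fst_mul, Mat.det_mul, Mat.det_mul, hz.1, mul_one, h1]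
  · rw [Prod.snd_mul, Prod.snd_mul, Mat.det_mul, Mat.det_mul, hz.2, mul_one, h2]

lemma exists_inv_of_mem {a : E} (ha : a ∈ SL2SL2) :
    ∃ a' : E, a' ∈ SL2SL2 ∧ a * a' = 1 ∧ a' * a = 1 := by
  refine ⟨(a.1⁻¹, a.2⁻¹), ⟨?_, ?_⟩, ?_, ?_⟩
  · have := det_mul_det_eq_one (Mat.mul_inv ha.1)
    rwa [ha.1, one_mul] at this
  · have := det_mul_det_eq_one (Mat.mul_inv ha.2)
    rwa [ha.2, one_mul] at this
  · exact Prod.ext (Mat.mul_inv ha.1) (Mat.mul_inv ha.2)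
  · exact Prod.ext (Mat.inv_mul ha.1) (Mat.inv_mul ha.2)

/-- There is an isometry with prescribed value at a point, acting on left trivialisations by
conjugation by a given matrix. -/
lemma exists_isometry {a b : E} (ha : a ∈ SL2SL2) (hb : b ∈ SL2SL2) {C D : Mat} (h : C * D = 1)
    (h' : D * C = 1) : ∃ K : E, IsIsometry (mulMul K (D, D)) ∧ mulMul K (D, D) a = b ∧
      ∀ x z : E, mulMul K (D, D) (x * z) = mulMul K (D, D) x * ((C, C) * z * (D, D)) := by
  obtain ⟨a', ha', e1, e2⟩ := exists_inv_of_mem ha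
  obtain ⟨b', hb', e3, e4⟩ := exists_inv_of_mem hb
  have hCD : ((C, C) : E) * (D, D) = 1 := Prod.ext h h
  have hDC : ((D, D) : E) * (C, C) = 1 := Prod.ext h' h'
  have hd := det_mul_det_eq_one h
  have hd' := det_mul_det_eq_one h'
  generalize hc : ((C, C) : E) = c at *
  generalize hdd : ((D, D) : E) = d at *
  have dc1 : c.1 = C := by rw [← hc]
  have dc2 : c.2 = C := by rw [← hc]
  have dd1 : d.1 = D := by rw [← hdd]
  have dd2 : d.2 = D := by rw [← hdd]
  -- The factor `d c = 1` is inserted between `x` and `z`. Taking `K = b c a⁻¹` makes the map send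
  -- `a` to `b`.
  have hmul : ∀ x z : E, mulMul (b * c * a') d (x * z) = mulMul (b * c * a') d x * (c * z * d) := by
    intro x z
    simp only [mulMul_apply]
    calc b * c * a' * (x * z) * d = b * c * a' * x * 1 * z * d := by noncomm_ring
      _ = _ := by rw [← hDC]; noncomm_ring
  have hmaps : ∀ z ∈ SL2SL2, mulMul (b * c * a') d z ∈ SL2SL2 := by
    intro z hz
    rw [mulMul_apply]
    refine mul_mem_SL2SL2 ?_ ?_ hz
    · rw [Prod.fst_mul, Prod.fst_mul, Mat.det_mul, Mat.det_mul, hb.1, ha'.1, dc1, dd1, one_mul,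
        mul_one, hd]
    · rw [Prod.snd_mul, Prod.snd_mul, Mat.det_mul, Mat.det_mul, hb.2, ha'.2, dc2, dd2, one_mul,
        mul_one, hd]
  have hmaps' : ∀ z ∈ SL2SL2, mulMul (a * d * b') c z ∈ SL2SL2 := by
    intro z hz
    rw [mulMul_apply]
    refine mul_mem_SL2SL2 ?_ ?_ hz
    · rw [Prod.fst_mul, Prod.fst_mul, Mat.det_mul, Mat.det_mul, ha.1, hb'.1, dc1, dd1, one_mul,
        mul_one, hd']
    · rw [Prod.snd_mul, Prod.snd_mul, Mat.det_mul, Mat.det_mul, ha.2, hb'.2, dc2, dd2, one_mul,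
        mul_one, hd']
  have inv1 : ∀ z, mulMul (a * d * b') c (mulMul (b * c * a') d z) = z := by
    intro z
    simp only [mulMul_apply]
    calc a * d * b' * (b * c * a' * z * d) * c = a * d * (b' * b) * c * a' * z * (d * c) := by
          noncomm_ring
      _ = a * (d * c) * a' * z * (d * c) := by rw [e4]; noncomm_ring
      _ = z := by rw [hDC, mul_one, mul_one, e1, one_mul]
  have inv2 : ∀ z, mulMul (b * c * a') d (mulMul (a * d * b') c z) = z := by
    intro z
    simp only [mulMul_apply]
    calc b * c * a' * (a * d * b' * z * c) * d = b * c * (a' * a) * d * b' * z * (c * d) := by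
          noncomm_ring
      _ = b * (c * d) * b' * z * (c * d) := by rw [e2]; noncomm_ring
      _ = z := by rw [hCD, mul_one, mul_one, e3, one_mul]
  refine ⟨b * c * a', ⟨?_, fun x _ => (mulMul _ _).contDiff.contDiffAt, ?_⟩, ?_, hmul⟩
  · exact Set.BijOn.mk hmaps (fun x _ y _ hxy => by rw [← inv1 x, hxy, inv1])
      fun y hy => ⟨_, hmaps' y hy, inv2 y⟩
  · intro x hx u _ v _
    have hu := leftMul_leftTriv hx u
    have hv := leftMul_leftTriv hx v
    rw [(mulMul _ _).fderiv, ← hu, ← hv, g_leftMul hx]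
    simp only [leftMul_apply, hmul]
    simp only [← leftMul_apply (mulMul _ _ x)]
    rw [g_leftMul (hmaps x hx), ← hc, ← hdd, gAlg_conj h]
  · rw [mulMul_apply]
    calc b * c * a' * a * d = b * c * (a' * a) * d := by noncomm_ring
      _ = b := by rw [e2, mul_one, mul_assoc, hCD, mul_one]

/-! ### The frame distribution -/

/-- The integral surfaces of this distribution are the surfaces satisfying the frame equations
with constants `a` and `b`. -/
def frameDist (a b : ℝ) (w : E × E) : Plane →L[ℝ] E × E :=
  (EuclideanSpace.proj (0 : Fin 2) : Plane →L[ℝ] ℝ).smulRight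
    ((w.1 * w.2, (a • nrm w.2, b • nrm w.2)) : E × E) +
  (EuclideanSpace.proj (1 : Fin 2) : Plane →L[ℝ] ℝ).smulRight
    ((w.1 * jAlg w.2, ((1 / √3 * (a - 2 * b - 2)) • nrm w.2,
      (1 / √3 * (2 * a - b - 2)) • nrm w.2)) : E × E)

lemma frameDist_apply (a b : ℝ) (w : E × E) (v : Plane) : frameDist a b w v =
    v 0 • ((w.1 * w.2, (a • nrm w.2, b • nrm w.2)) : E × E) +
    v 1 • ((w.1 * jAlg w.2, ((1 / √3 * (a - 2 * b - 2)) • nrm w.2,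
      (1 / √3 * (2 * a - b - 2)) • nrm w.2)) : E × E) := rfl

lemma contDiff_frameDist (a b : ℝ) : ContDiff ℝ ∞ (frameDist a b) := by
  have hn : ContDiff ℝ ∞ fun w : E × E => nrm w.2 :=
    contDiffOn_univ.1 (contDiffOn_nrm contDiff_snd.contDiffOn)
  have hj : ContDiff ℝ ∞ fun w : E × E => jAlg w.2 :=
    jAlg.toContinuousLinearMap.contDiff.comp contDiff_snd
  refine ContDiff.add (contDiff_const.smulRight ?_) (contDiff_const.smulRight ?_)
  · exact (contDiff_fst.mul contDiff_snd).prodMk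
      ((hn.const_smul _).prodMk (hn.const_smul _))
  · exact (contDiff_fst.mul hj).prodMk
      ((hn.const_smul _).prodMk (hn.const_smul _))

lemma frameDist_injective (a b : ℝ) {w : E × E} (h1 : w.1 ∈ SL2SL2) (h2 : IsFrame w.2) :
    Function.Injective (frameDist a b w) := by
  rw [injective_iff_map_eq_zero]
  intro v hv
  have h := congrArg Prod.fst hv
  rw [frameDist_apply] at h
  have h' : w.1 * (v 0 • w.2 + v 1 • jAlg w.2) = w.1 * 0 := by
    rw [mul_zero, mul_add, mul_smul_comm, mul_smul_comm]; exact h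
  obtain ⟨h3, h4⟩ := jAlg_independent h2.ne_zero _ _ (eq_of_mul_eq h1 h')
  ext i
  fin_cases i
  · exact h3
  · exact h4

/-- A framed surface with constant coefficients, together with its frame, is an integral surface
after applying a map which multiplies frames by a conjugation. -/
lemma IsFramedSurface.frameDist_eq {W : Set Plane} {f : Plane → E} {X Y : Plane → Plane}
    {ξ : Plane → E} (h : IsFramedSurface W f X Y ξ) {a b : ℝ}
    (ha : ∀ u ∈ W, coeffA ξ X u = a) (hb : ∀ u ∈ W, coeffB ξ X u = b) (Φ : E →L[ℝ] E) (C D : Mat)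
    (hDC : D * C = 1) (hΦ : ∀ x z : E, Φ (x * z) = Φ x * ((C, C) * z * (D, D))) {u : Plane}
    (hu : u ∈ W) :
    frameDist a b (Φ (f u), mulMul (C, C) (D, D) (ξ u)) =
      fderiv ℝ (fun x => (Φ (f x), mulMul (C, C) (D, D) (ξ x))) u ∘L
        ((EuclideanSpace.proj (0 : Fin 2) : Plane →L[ℝ] ℝ).smulRight (X u) +
          (EuclideanSpace.proj (1 : Fin 2) : Plane →L[ℝ] ℝ).smulRight (Y u)) := by
  have hf := ((h.smooth.contDiffAt (h.isOpen.mem_nhds hu)).differentiableAt (by simp)).hasFDerivAt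
  have hξ := h.hasFDerivAt_frame hu
  have hd : HasFDerivAt (fun x => (Φ (f x), mulMul (C, C) (D, D) (ξ x))) _ u :=
    (Φ.hasFDerivAt.comp u hf).prodMk ((mulMul (C, C) (D, D)).hasFDerivAt.comp u hξ)
  have hn : nrm (mulMul (C, C) (D, D) (ξ u)) = C * nrm (ξ u) * D := by
    rw [mulMul_apply]
    simp only [nrm, Prod.fst_mul, Prod.snd_mul]
    calc _ = C * (ξ u).1 * (D * C) * (ξ u).2 * D - C * (ξ u).2 * (D * C) * (ξ u).1 * D := by
          noncomm_ring
      _ = _ := by rw [hDC]; noncomm_ring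
  have hj : jAlg (mulMul (C, C) (D, D) (ξ u)) = (C, C) * jAlg (ξ u) * (D, D) := by
    rw [mulMul_apply]
    ext1
    · simp only [jAlg_fst, Prod.fst_mul, Prod.snd_mul, mul_smul_comm, smul_mul_assoc, mul_sub,
        sub_mul]
    · simp only [jAlg_snd, Prod.fst_mul, Prod.snd_mul, mul_smul_comm, smul_mul_assoc, mul_sub,
        sub_mul]
  have hsm : ∀ s t : ℝ, mulMul (C, C) (D, D) (s • nrm (ξ u), t • nrm (ξ u)) =
      (s • (C * nrm (ξ u) * D), t • (C * nrm (ξ u) * D)) := by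
    intro s t
    rw [mulMul_apply]
    ext1 <;> simp
  ext1 v
  rw [hd.fderiv, frameDist_apply, hn, hj]
  simp only [ContinuousLinearMap.comp_apply, add_apply, ContinuousLinearMap.smulRight_apply,
    ContinuousLinearMap.prod_apply, map_add, map_smul, h.fderiv_X u hu, h.fderiv_Y u hu,
    h.fderiv_frame_X hu, h.fderiv_frame_Y hu, ha u hu, hb u hu, hsm, hΦ, mulMul_apply]
  rfl

/-! ### Surfaces in a coordinate domain -/

/-- The pair of adjugate matrices. -/
def adjE : E →ₗ[ℝ] E where
  toFun a := (a.1.trace • 1 - a.1, a.2.trace • 1 - a.2)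
  map_add' x y := by
    have h : ∀ A B : Mat, (A + B).trace = A.trace + B.trace := fun A B => by
      simp only [Mat.trace_eq, Mat.add_apply]; ring
    ext1 <;> simp only [Prod.fst_add, Prod.snd_add, h] <;> module
  map_smul' c x := by
    have h : ∀ A : Mat, (c • A).trace = c * A.trace := fun A => by
      simp only [Mat.trace_eq, Mat.smul_apply]; ring
    ext1 <;> simp only [Prod.smul_fst, Prod.smul_snd, h, RingHom.id_apply] <;> module

/-- Cayley–Hamilton. It makes `leftTriv` polynomial along `SL2SL2`, which gives the smoothness of
left trivialisations. -/
lemma Mat.inv_eq {A : Mat} (hA : A.det = 1) : A⁻¹ = A.trace • 1 - A := by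
  have h : A * (A.trace • 1 - A) = 1 := by
    rw [Mat.det_eq] at hA
    refine Mat.ext fun i j => ?_
    fin_cases i <;> fin_cases j <;>
    simp [Mat.mul_apply, Mat.sub_apply, Mat.smul_apply, Mat.one_apply, Mat.trace_eq] <;>
    first | linear_combination hA | ring
  calc A⁻¹ = A⁻¹ * (A * (A.trace • 1 - A)) := by rw [h, mul_one]
    _ = _ := by rw [← mul_assoc, Mat.inv_mul hA, one_mul]

lemma leftTriv_eq {a : E} (ha : a ∈ SL2SL2) (z : E) : leftTriv a z = adjE a * z :=
  Prod.ext (congrArg (· * z.1) (Mat.inv_eq ha.1)) (congrArg (· * z.2) (Mat.inv_eq ha.2))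

lemma trace_inv_mul {A B : Mat} (hA : A.det = 1) : (A⁻¹ * B).trace = -2 * inner4 B A := by
  rw [Mat.inv_eq hA]
  simp only [inner4, Mat.trace_eq, Mat.mul_apply, Mat.sub_apply, Mat.smul_apply, Mat.one_apply]
  simp only [Fin.isValue, if_true, zero_ne_one, one_ne_zero, if_false]
  ring

lemma inner4_self_eq (A : Mat) : inner4 A A = -A.det := by
  rw [Mat.det_eq, inner4]; ring

lemma J_mul {a : E} (ha : a ∈ SL2SL2) (z : E) : J a (a * z) = a * jAlg z := by
  rw [← leftMul_apply, ← leftMul_apply]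
  simp only [J, LinearMap.comp_apply, leftTriv_leftMul ha]

lemma P_mul {a : E} (ha : a ∈ SL2SL2) (z : E) : P a (a * z) = a * pAlg z := by
  rw [← leftMul_apply, ← leftMul_apply]
  simp only [P, LinearMap.comp_apply, leftTriv_leftMul ha]

lemma g_mul {a : E} (ha : a ∈ SL2SL2) (z w : E) : g a (a * z) (a * w) = gAlg z w :=
  g_leftMul ha z w

lemma mul_leftTriv {a : E} (ha : a ∈ SL2SL2) (z : E) : a * leftTriv a z = z :=
  leftMul_leftTriv ha z

lemma leftTriv_mul {a : E} (ha : a ∈ SL2SL2) (z : E) : leftTriv a (a * z) = z :=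
  leftTriv_leftMul ha z

/-- The derivative of `det = 1`, in the form `inner4 A A = -1`. -/
lemma isTraceless_leftTriv_fderiv {W : Set Plane} {f : Plane → E} (hW : IsOpen W)
    (hmem : ∀ u ∈ W, f u ∈ SL2SL2) (hf : ContDiffOn ℝ ∞ f W) {u : Plane} (hu : u ∈ W)
    (v : Plane) : IsTraceless (leftTriv (f u) (fderiv ℝ f u v)) := by
  have hd := ((hf.contDiffAt (hW.mem_nhds hu)).differentiableAt (by simp)).hasFDerivAt
  have h1 := inner4_derivative hd (hW.mem_nhds hu) (ContinuousLinearMap.fst ℝ Mat Mat)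
    (ContinuousLinearMap.fst ℝ Mat Mat) (c := -1)
    (fun x hx => by rw [inner4_self_eq]; exact congrArg Neg.neg (hmem x hx).1) v
  have h2 := inner4_derivative hd (hW.mem_nhds hu) (ContinuousLinearMap.snd ℝ Mat Mat)
    (ContinuousLinearMap.snd ℝ Mat Mat) (c := -1)
    (fun x hx => by rw [inner4_self_eq]; exact congrArg Neg.neg (hmem x hx).2) v
  simp only [ContinuousLinearMap.coe_fst', ContinuousLinearMap.coe_snd'] at h1 h2
  rw [inner4_comm (f u).1] at h1
  rw [inner4_comm (f u).2] at h2
  constructor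
  · change ((f u).1⁻¹ * (fderiv ℝ f u v).1).trace = 0
    rw [trace_inv_mul (hmem u hu).1]; linarith
  · change ((f u).2⁻¹ * (fderiv ℝ f u v).2).trace = 0
    rw [trace_inv_mul (hmem u hu).2]; linarith

/-- A surface in a coordinate domain `W` whose tangent planes are `J`-invariant. -/
structure IsComplexSurface (W : Set Plane) (f : Plane → E) : Prop where
  isOpen : IsOpen W
  mem : ∀ u ∈ W, f u ∈ SL2SL2
  smooth : ContDiffOn ℝ ∞ f W
  injective : ∀ u ∈ W, Function.Injective (fderiv ℝ f u)
  exists_J : ∀ u ∈ W, ∀ v, ∃ w, fderiv ℝ f u w = J (f u) (fderiv ℝ f u v)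

namespace IsComplexSurface

variable {W : Set Plane} {f : Plane → E} {X : Plane → Plane}

lemma mono (h : IsComplexSurface W f) {W' : Set Plane} (hW' : IsOpen W') (hs : W' ⊆ W) :
    IsComplexSurface W' f :=
  ⟨hW', fun u hu => h.mem u (hs hu), h.smooth.mono hs, fun u hu => h.injective u (hs hu),
    fun u hu => h.exists_J u (hs hu)⟩

lemma contDiffOn_leftTriv (h : IsComplexSurface W f) (hX : ContDiffOn ℝ ∞ X W) :
    ContDiffOn ℝ ∞ (fun u => leftTriv (f u) (fderiv ℝ f u (X u))) W := by
  have h1 : ContDiffOn ℝ ∞ (fun u => fderiv ℝ f u (X u)) W :=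
    (h.smooth.fderiv_of_isOpen h.isOpen (by simp)).clm_apply hX
  have h2 : ContDiffOn ℝ ∞ (fun u => adjE.toContinuousLinearMap (f u)) W :=
    adjE.toContinuousLinearMap.contDiff.comp_contDiffOn h.smooth
  exact (h2.mul h1).congr fun u hu => leftTriv_eq (h.mem u hu) _

/-- The field `JX`. -/
lemma exists_rotated (h : IsComplexSurface W f) (hX : ContDiffOn ℝ ∞ X W) :
    ∃ Y : Plane → Plane, ContDiffOn ℝ ∞ Y W ∧ ∀ u ∈ W,
      fderiv ℝ f u (Y u) = f u * jAlg (leftTriv (f u) (fderiv ℝ f u (X u))) := by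
  have hex : ∀ u, ∃ w, u ∈ W →
      fderiv ℝ f u w = f u * jAlg (leftTriv (f u) (fderiv ℝ f u (X u))) := by
    intro u
    by_cases hu : u ∈ W
    · obtain ⟨w, hw⟩ := h.exists_J u hu (X u)
      refine ⟨w, fun _ => ?_⟩
      rw [hw, ← J_mul (h.mem u hu), mul_leftTriv (h.mem u hu)]
    · exact ⟨0, fun hu' => absurd hu' hu⟩
  choose Y hY using hex
  refine ⟨Y, fun u hu => ?_, hY⟩
  have hn := h.isOpen.mem_nhds hu
  have hZ : ContDiffOn ℝ ∞
      (fun u => f u * jAlg.toContinuousLinearMap (leftTriv (f u) (fderiv ℝ f u (X u)))) W :=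
    h.smooth.mul (jAlg.toContinuousLinearMap.contDiff.comp_contDiffOn (h.contDiffOn_leftTriv hX))
  -- The pointwise choice of `Y` is smooth because it solves an injective linear system with smooth
  -- coefficients.
  exact (contDiffAt_of_clm_apply_eq
    ((h.smooth.fderiv_of_isOpen h.isOpen (m := ∞) (by simp)).contDiffAt hn)
    (hZ.contDiffAt hn) (h.injective u hu) (Filter.mem_of_superset hn hY)).contDiffWithinAt

lemma exists_isFramedSurface (h : IsComplexSurface W f) (hX : ContDiffOn ℝ ∞ X W)
    (hF : ∀ u ∈ W, IsFrame (leftTriv (f u) (fderiv ℝ f u (X u)))) :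
    ∃ Y, IsFramedSurface W f X Y (fun u => leftTriv (f u) (fderiv ℝ f u (X u))) := by
  obtain ⟨Y, hY, hY'⟩ := h.exists_rotated hX
  exact ⟨Y, h.isOpen, h.mem, h.smooth, hX, hY, h.contDiffOn_leftTriv hX,
    fun u hu => (mul_leftTriv (h.mem u hu) _).symm, hY', hF⟩

end IsComplexSurface

/-! ### The complex quadratic form of `P` and normalized fields. -/

/-- The complex number `g(ξ, Pξ) + i g(ξ, JPξ)`. -/
def pForm (ξ : E) : ℂ := ⟨gAlg ξ (pAlg ξ), gAlg ξ (jAlg (pAlg ξ))⟩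

/-- Normalizing thus amounts to extracting a complex square root, which explains both the existence
of normalized vectors and their uniqueness up to sign. -/
lemma pForm_comb (ξ : E) (c : ℂ) : pForm (c.re • ξ + c.im • jAlg ξ) = c ^ 2 * pForm ξ := by
  apply Complex.ext
  · simp only [pForm, gAlg_pAlg_comb, pow_two, Complex.mul_re, Complex.mul_im]; ring
  · simp only [pForm, gAlg_jAlg_pAlg_comb, pow_two, Complex.mul_re, Complex.mul_im]; ring

lemma pForm_eq_one_iff {ξ : E} :
    pForm ξ = 1 ↔ gAlg ξ (pAlg ξ) = 1 ∧ gAlg ξ (jAlg (pAlg ξ)) = 0 := by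
  rw [Complex.ext_iff]; rfl

lemma contDiffOn_gAlg {ξ η : Plane → E} {W : Set Plane} (hξ : ContDiffOn ℝ ∞ ξ W)
    (hη : ContDiffOn ℝ ∞ η W) : ContDiffOn ℝ ∞ (fun u => gAlg (ξ u) (η u)) W := by
  have h1 : ContDiffOn ℝ ∞ (fun x => (ξ x).1) W := contDiff_fst.comp_contDiffOn hξ
  have h2 : ContDiffOn ℝ ∞ (fun x => (ξ x).2) W := contDiff_snd.comp_contDiffOn hξ
  have h3 : ContDiffOn ℝ ∞ (fun x => (η x).1) W := contDiff_fst.comp_contDiffOn hη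
  have h4 : ContDiffOn ℝ ∞ (fun x => (η x).2) W := contDiff_snd.comp_contDiffOn hη
  simp only [gAlg_eq_inner4]
  exact (contDiffOn_const.mul ((ContDiffOn.inner4 h1 h3).add (ContDiffOn.inner4 h2 h4))).sub
    (contDiffOn_const.mul ((ContDiffOn.inner4 h2 h3).add (ContDiffOn.inner4 h1 h4)))

lemma contDiffOn_pForm {ξ : Plane → E} {W : Set Plane} (hξ : ContDiffOn ℝ ∞ ξ W) :
    ContDiffOn ℝ ∞ (fun u => pForm (ξ u)) W := by
  have hp : ContDiffOn ℝ ∞ (fun u => pAlg (ξ u)) W :=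
    pAlg.toContinuousLinearMap.contDiff.comp_contDiffOn hξ
  have hj : ContDiffOn ℝ ∞ (fun u => jAlg (pAlg (ξ u))) W :=
    jAlg.toContinuousLinearMap.contDiff.comp_contDiffOn hp
  exact Complex.equivRealProdCLM.symm.contDiff.comp_contDiffOn
    ((contDiffOn_gAlg hξ hp).prodMk (contDiffOn_gAlg hξ hj))

/-- A local field `X` with `g(X, PX) = 1` and `g(X, JPX) = 0`. -/
lemma IsComplexSurface.exists_normalized {W : Set Plane} {f : Plane → E}
    (h : IsComplexSurface W f) {u₀ : Plane} (hu₀ : u₀ ∈ W) {v₀ : Plane}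
    (hP : pForm (leftTriv (f u₀) (fderiv ℝ f u₀ v₀)) ≠ 0) :
    ∃ (W' : Set Plane) (X : Plane → Plane), IsOpen W' ∧ W' ⊆ W ∧ u₀ ∈ W' ∧
      ContDiffOn ℝ ∞ X W' ∧ ∀ u ∈ W', pForm (leftTriv (f u) (fderiv ℝ f u (X u))) = 1 := by
  have hc : ContDiffOn ℝ ∞ (fun _ : Plane => v₀) W := contDiffOn_const
  obtain ⟨Y, hY, hY'⟩ := h.exists_rotated hc
  have hh := contDiffOn_pForm (h.contDiffOn_leftTriv hc)
  set q : Plane → ℂ := fun u => pForm (leftTriv (f u) (fderiv ℝ f u v₀)) with hq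
  -- A smooth square root of `1 / q` is wanted near `u₀`. Dividing `q` by `q u₀` moves the value at
  -- `u₀` to `1`, where the principal logarithm is smooth; `ζ` restores the constant factor.
  obtain ⟨ζ, hζ⟩ := IsAlgClosed.exists_eq_mul_self (q u₀)⁻¹
  set q' : Plane → ℂ := fun u => q u * (q u₀)⁻¹ with hq'
  have hq'c : ContDiffOn ℝ ∞ q' W := hh.mul contDiffOn_const
  set W' := W ∩ q' ⁻¹' Complex.slitPlane
  have hW' : IsOpen W' := hq'c.continuousOn.isOpen_inter_preimage h.isOpen Complex.isOpen_slitPlane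
  set c : Plane → ℂ := fun u => ζ * Complex.exp (-(Complex.log (q' u) / 2)) with hcdef
  have hcs : ContDiffOn ℝ ∞ c W' := by
    intro u hu
    have h1 : ContDiffAt ℝ ∞ q' u := hq'c.contDiffAt (h.isOpen.mem_nhds hu.1)
    have h2 : ContDiffAt ℝ ∞ Complex.log (q' u) :=
      (Complex.contDiffAt_log (n := ∞) hu.2).restrict_scalars ℝ
    have h3 : ContDiffAt ℝ ∞ Complex.exp (-(Complex.log (q' u) / 2)) :=
      (Complex.contDiff_exp (𝕜 := ℂ)).contDiffAt.restrict_scalars ℝ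
    have h4 : ContDiffAt ℝ ∞ (fun u => -(Complex.log (q' u) / 2)) u :=
      ((h2.comp u h1).div_const 2).neg
    exact (contDiffAt_const.mul (h3.comp u h4)).contDiffWithinAt
  refine ⟨W', fun u => (c u).re • v₀ + (c u).im • Y u, hW', Set.inter_subset_left, ⟨hu₀, ?_⟩,
    ?_, ?_⟩
  · change q u₀ * (q u₀)⁻¹ ∈ Complex.slitPlane
    rw [mul_inv_cancel₀ hP]
    exact Complex.one_mem_slitPlane
  · exact ((Complex.reCLM.contDiff.comp_contDiffOn hcs).smul contDiffOn_const).add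
      ((Complex.imCLM.contDiff.comp_contDiffOn hcs).smul (hY.mono Set.inter_subset_left))
  · intro u hu
    have h0 : q' u ≠ 0 := Complex.slitPlane_ne_zero hu.2
    have hmem := h.mem u hu.1
    have e : leftTriv (f u) (fderiv ℝ f u ((c u).re • v₀ + (c u).im • Y u)) =
        (c u).re • leftTriv (f u) (fderiv ℝ f u v₀) +
          (c u).im • jAlg (leftTriv (f u) (fderiv ℝ f u v₀)) := by
      rw [map_add, map_smul, map_smul, hY' u hu.1, map_add, map_smul, map_smul, leftTriv_mul hmem]
    rw [e, pForm_comb]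
    have e1 : Complex.exp (-(Complex.log (q' u) / 2)) ^ 2 = (q' u)⁻¹ := by
      rw [← Complex.exp_nat_mul, ← Complex.exp_log h0, ← Complex.exp_neg, Complex.exp_log h0]
      congr 1; push_cast; ring
    have e2 : c u ^ 2 = (q u)⁻¹ := by
      rw [hcdef]
      simp only
      rw [mul_pow, e1, pow_two, ← hζ, hq']
      simp only
      rw [mul_inv, inv_inv]
      have hP' : q u₀ ≠ 0 := hP
      rw [mul_left_comm, inv_mul_cancel₀ hP', mul_one]
    rw [e2]
    refine inv_mul_cancel₀ (left_ne_zero_of_mul h0)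

/-! ### Surfaces as manifolds -/

section Manifold

variable {S : Type*} [TopologicalSpace S] [ChartedSpace (EuclideanSpace ℝ (Fin 2)) S]

/-- The left trivialisation of the image of a tangent vector. -/
def triv (F : S → E) (x : S) (v : TangentSpace (𝓡 2) x) : E := leftTriv (F x) (dE F x v)

lemma triv_add (F : S → E) (x : S) (v w : TangentSpace (𝓡 2) x) :
    triv F x (v + w) = triv F x v + triv F x w := by
  simp only [triv, map_add]

lemma triv_smul (F : S → E) (x : S) (c : ℝ) (v : TangentSpace (𝓡 2) x) :
    triv F x (c • v) = c • triv F x v := by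
  simp only [triv, map_smul]

section Pointwise

variable {F : S → E} (hF : IsDegenerateAlmostComplex F) {x : S}
include hF

lemma IsDegenerateAlmostComplex.dE_eq (v : TangentSpace (𝓡 2) x) :
    dE F x v = F x * triv F x v := (mul_leftTriv (hF.mem x) _).symm

lemma IsDegenerateAlmostComplex.triv_injective {v w : TangentSpace (𝓡 2) x}
    (h : triv F x v = triv F x w) : v = w :=
  hF.immersion x (by rw [hF.dE_eq, hF.dE_eq, h])

lemma IsDegenerateAlmostComplex.exists_triv_jAlg (v : TangentSpace (𝓡 2) x) :
    ∃ w : TangentSpace (𝓡 2) x, triv F x w = jAlg (triv F x v) := by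
  have h1 : J (F x) (dE F x v) ∈ tangentPlane F x := by
    rw [← hF.almostComplex x]
    exact Submodule.mem_map_of_mem ⟨v, rfl⟩
  obtain ⟨w, hw⟩ := h1
  refine ⟨w, eq_of_mul_eq (hF.mem x) ?_⟩
  rw [← hF.dE_eq, ← J_mul (hF.mem x), ← hF.dE_eq]
  exact hw

lemma IsDegenerateAlmostComplex.gAlg_triv (v w : TangentSpace (𝓡 2) x) :
    gAlg (triv F x v) (triv F x w) = 0 := by
  rw [← g_mul (hF.mem x), ← hF.dE_eq, ← hF.dE_eq]
  exact hF.degenerate x _ ⟨v, rfl⟩ _ ⟨w, rfl⟩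

lemma IsDegenerateAlmostComplex.isNormalized_iff (v : TangentSpace (𝓡 2) x) :
    IsNormalized F x v ↔ pForm (triv F x v) = 1 := by
  rw [IsNormalized, pForm_eq_one_iff, hF.dE_eq, P_mul (hF.mem x), J_mul (hF.mem x),
    g_mul (hF.mem x), g_mul (hF.mem x)]

lemma IsDegenerateAlmostComplex.exists_triv_comb {v : TangentSpace (𝓡 2) x}
    (hv : triv F x v ≠ 0) (w : TangentSpace (𝓡 2) x) :
    ∃ c : ℂ, triv F x w = c.re • triv F x v + c.im • jAlg (triv F x v) := by
  obtain ⟨v', hv'⟩ := hF.exists_triv_jAlg v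
  have hd : Module.finrank ℝ (TangentSpace (𝓡 2) x) = 2 :=
    finrank_euclideanSpace_fin (𝕜 := ℝ) (n := 2)
  obtain ⟨p, q, hpq⟩ := exists_eq_smul_add_smul hd (v := v) (w := v') (fun s t hst => by
      refine jAlg_independent hv s t ?_
      rw [← hv', ← triv_smul, ← triv_smul, ← triv_add, hst, triv, map_zero, map_zero]) w
  refine ⟨⟨p, q⟩, ?_⟩
  rw [hpq, triv_add, triv_smul, triv_smul, hv']

/-- Normalized vectors are unique up to sign. -/
lemma IsDegenerateAlmostComplex.eq_or_eq_neg {v w : TangentSpace (𝓡 2) x}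
    (hv : IsNormalized F x v) (hw : IsNormalized F x w) : w = v ∨ w = -v := by
  rw [hF.isNormalized_iff] at hv hw
  have hv0 : triv F x v ≠ 0 := by
    intro h0
    rw [h0] at hv
    have := congrArg Complex.re hv
    simp [pForm, gAlg_eq_inner4, inner4_zero_left] at this
  obtain ⟨c, hc⟩ := hF.exists_triv_comb hv0 w
  rw [hc, pForm_comb, hv, mul_one] at hw
  rcases (sq_eq_one_iff (R := ℂ)).1 hw with rfl | rfl
  · left
    exact hF.triv_injective (by simpa using hc)
  · right
    refine hF.triv_injective ?_
    rw [← neg_one_smul ℝ v, triv_smul, hc]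
    simp

end Pointwise

section Chart

/-- The expression of a tangent vector in the chart at `x₀`. -/
def chartVec (x₀ y : S) : TangentSpace (𝓡 2) y →L[ℝ] Plane :=
  mfderiv (𝓡 2) (𝓡 2) (chartAt Plane x₀) y

lemma IsDegenerateAlmostComplex.mdifferentiableAt {F : S → E} (hF : IsDegenerateAlmostComplex F)
    (y : S) : MDifferentiableAt (𝓡 2) 𝓘(ℝ, E) F y :=
  hF.smooth.mdifferentiable (by simp) y

lemma comp_chart_apply {α : Type*} (Z : S → α) {x₀ y : S} (hy : y ∈ (chartAt Plane x₀).source) :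
    (Z ∘ (chartAt Plane x₀).symm) (chartAt Plane x₀ y) = Z y := by
  rw [Function.comp_apply, (chartAt Plane x₀).left_inv hy]

/-- The expression of a vector field in the chart at `x₀`. -/
def chartField (x₀ : S) (X : (x : S) → TangentSpace (𝓡 2) x) (u : Plane) : Plane :=
  chartVec x₀ ((chartAt Plane x₀).symm u) (X ((chartAt Plane x₀).symm u))

lemma chartField_apply {x₀ y : S} (hy : y ∈ (chartAt Plane x₀).source)
    (X : (x : S) → TangentSpace (𝓡 2) x) :
    chartField x₀ X (chartAt Plane x₀ y) = chartVec x₀ y (X y) := by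
  change (fun z => chartVec x₀ z (X z)) ((chartAt Plane x₀).symm (chartAt Plane x₀ y)) = _
  rw [(chartAt Plane x₀).left_inv hy]

variable [IsManifold (𝓡 2) ∞ S]

lemma chartVec_bijective {x₀ y : S} (hy : y ∈ (chartAt Plane x₀).source) :
    Function.Bijective (chartVec x₀ y) :=
  (mdifferentiable_chart (I := 𝓡 2) x₀).mfderiv_bijective hy

lemma differentiableAt_comp_chart {Z : S → E} {x₀ y : S} (hy : y ∈ (chartAt Plane x₀).source)
    (hZ : MDifferentiableAt (𝓡 2) 𝓘(ℝ, E) Z y) :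
    MDifferentiableAt 𝓘(ℝ, Plane) 𝓘(ℝ, E) (Z ∘ (chartAt Plane x₀).symm) (chartAt Plane x₀ y) := by
  refine MDifferentiableAt.comp (I' := 𝓡 2) _ ?_
    ((mdifferentiable_chart (I := 𝓡 2) x₀).mdifferentiableAt_symm
      ((chartAt Plane x₀).map_source hy))
  rwa [(chartAt Plane x₀).left_inv hy]

lemma dE_eq_fderiv {Z : S → E} {x₀ y : S} (hy : y ∈ (chartAt Plane x₀).source)
    (hZ : MDifferentiableAt (𝓡 2) 𝓘(ℝ, E) Z y) (v : TangentSpace (𝓡 2) y) :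
    dE Z y v = fderiv ℝ (Z ∘ (chartAt Plane x₀).symm) (chartAt Plane x₀ y) (chartVec x₀ y v) := by
  have h1 := differentiableAt_comp_chart hy hZ
  have h2 := (mdifferentiable_chart (I := 𝓡 2) x₀).mdifferentiableAt hy
  have h3 : mfderiv (𝓡 2) 𝓘(ℝ, E) ((Z ∘ (chartAt Plane x₀).symm) ∘ (chartAt Plane x₀)) y =
      (mfderiv 𝓘(ℝ, Plane) 𝓘(ℝ, E) (Z ∘ (chartAt Plane x₀).symm) (chartAt Plane x₀ y)).comp
        (mfderiv (𝓡 2) (𝓡 2) (chartAt Plane x₀) y) := mfderiv_comp y h1 h2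
  have h4 : (Z ∘ (chartAt Plane x₀).symm) ∘ (chartAt Plane x₀) =ᶠ[𝓝 y] Z := by
    filter_upwards [(chartAt Plane x₀).open_source.mem_nhds hy] with z hz
    simp [(chartAt Plane x₀).left_inv hz]
  rw [h4.mfderiv_eq, mfderiv_eq_fderiv] at h3
  exact congrArg (fun l => l v) h3

lemma IsDegenerateAlmostComplex.isComplexSurface {F : S → E} (hF : IsDegenerateAlmostComplex F)
    (x₀ : S) : IsComplexSurface (chartAt Plane x₀).target (F ∘ (chartAt Plane x₀).symm) where
  isOpen := (chartAt Plane x₀).open_target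
  mem u _ := hF.mem _
  smooth := by
    have := hF.smooth.comp_contMDiffOn (contMDiffOn_chart_symm (I := 𝓡 2) (x := x₀) (n := ∞))
    exact contMDiffOn_iff_contDiffOn.1 this
  injective u hu := by
    obtain ⟨y, hy, rfl⟩ : ∃ y ∈ (chartAt Plane x₀).source, chartAt Plane x₀ y = u :=
      ⟨_, (chartAt Plane x₀).map_target hu, (chartAt Plane x₀).right_inv hu⟩
    intro v w hvw
    obtain ⟨v', rfl⟩ := (chartVec_bijective hy).2 v
    obtain ⟨w', rfl⟩ := (chartVec_bijective hy).2 w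
    rw [← dE_eq_fderiv hy (hF.mdifferentiableAt y), ← dE_eq_fderiv hy (hF.mdifferentiableAt y)]
      at hvw
    rw [hF.immersion y hvw]
  exists_J u hu v := by
    obtain ⟨y, hy, rfl⟩ : ∃ y ∈ (chartAt Plane x₀).source, chartAt Plane x₀ y = u :=
      ⟨_, (chartAt Plane x₀).map_target hu, (chartAt Plane x₀).right_inv hu⟩
    obtain ⟨v', rfl⟩ := (chartVec_bijective hy).2 v
    obtain ⟨w, hw⟩ := hF.exists_triv_jAlg v'
    refine ⟨chartVec x₀ y w, ?_⟩
    rw [← dE_eq_fderiv hy (hF.mdifferentiableAt y), ← dE_eq_fderiv hy (hF.mdifferentiableAt y),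
      comp_chart_apply F hy, hF.dE_eq, hF.dE_eq, J_mul (hF.mem y), hw]

lemma IsDegenerateAlmostComplex.leftTriv_chart {F : S → E} (hF : IsDegenerateAlmostComplex F)
    {x₀ y : S} (hy : y ∈ (chartAt Plane x₀).source) (v : TangentSpace (𝓡 2) y) :
    leftTriv ((F ∘ (chartAt Plane x₀).symm) (chartAt Plane x₀ y))
      (fderiv ℝ (F ∘ (chartAt Plane x₀).symm) (chartAt Plane x₀ y) (chartVec x₀ y v)) =
      triv F y v := by
  rw [← dE_eq_fderiv hy (hF.mdifferentiableAt y), comp_chart_apply F hy, triv]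

lemma IsDegenerateAlmostComplex.isTraceless {F : S → E} (hF : IsDegenerateAlmostComplex F)
    {y : S} (v : TangentSpace (𝓡 2) y) : IsTraceless (triv F y v) := by
  have h := hF.isComplexSurface y
  rw [← hF.leftTriv_chart (mem_chart_source Plane y)]
  exact isTraceless_leftTriv_fderiv h.isOpen h.mem h.smooth (mem_chart_target Plane y) _

lemma IsDegenerateAlmostComplex.isFrame {F : S → E} (hF : IsDegenerateAlmostComplex F)
    {y : S} {v : TangentSpace (𝓡 2) y} (hv : IsNormalized F y v) : IsFrame (triv F y v) := by
  rw [hF.isNormalized_iff, pForm_eq_one_iff] at hv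
  exact isFrame_of_gAlg (hF.isTraceless v) (hF.gAlg_triv v v) hv.1 hv.2

lemma pAlg_pAlg (ξ : E) : pAlg (pAlg ξ) = ξ := rfl

/-- If the form vanished at `v ≠ 0`, then `P` would map `v` into the complex line it spans, that is,
the tangent plane. As `P` anticommutes with `J` and is an involution, it would preserve the whole
plane. -/
lemma IsDegenerateAlmostComplex.pForm_ne_zero {F : S → E} (hF : IsDegenerateAlmostComplex F)
    (hP : PNotPreserving F) {y : S} {v : TangentSpace (𝓡 2) y} (hv : v ≠ 0) :
    pForm (triv F y v) ≠ 0 := by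
  intro h0
  have hv0 : triv F y v ≠ 0 := fun h => hv (hF.triv_injective (by rw [h, triv, map_zero, map_zero]))
  obtain ⟨p, q, hpq⟩ := pAlg_mem_of_gAlg_eq_zero (hF.isTraceless v) (hF.gAlg_triv v v)
    (congrArg Complex.re h0) (congrArg Complex.im h0)
  obtain ⟨v', hv'⟩ := hF.exists_triv_jAlg v
  have hle : ∀ w : TangentSpace (𝓡 2) y, P (F y) (dE F y w) ∈ tangentPlane F y := by
    intro w
    obtain ⟨c, hc⟩ := hF.exists_triv_comb hv0 w
    -- The coordinates of `P(cξ) = c̄ Pξ = c̄ (p + iq) ξ`.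
    refine ⟨(c.re * p + c.im * q) • v + (c.re * q - c.im * p) • v', ?_⟩
    change dE F y ((c.re * p + c.im * q) • v + (c.re * q - c.im * p) • v') = _
    rw [hF.dE_eq, hF.dE_eq, P_mul (hF.mem y), hc, triv_add, triv_smul, triv_smul, hv', map_add,
      map_smul, map_smul, pAlg_jAlg, hpq, map_add, map_smul, map_smul, jAlg_jAlg]
    congr 1
    module
  refine hP y (le_antisymm ?_ ?_)
  · rintro _ ⟨_, ⟨w, rfl⟩, rfl⟩
    exact hle w
  · rintro _ ⟨w, rfl⟩
    have h1 := hle w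
    refine ⟨_, h1, ?_⟩
    change P (F y) (P (F y) (dE F y w)) = dE F y w
    rw [hF.dE_eq, P_mul (hF.mem y), P_mul (hF.mem y), pAlg_pAlg]

/-- The trivialization of the tangent bundle at `x₀` is the differential of the chart, so smoothness
of a section can be tested on its chart expression. -/
lemma contMDiffOn_field_iff {x₀ : S} {X : (x : S) → TangentSpace (𝓡 2) x} {U : Set S}
    (hU : IsOpen U) (hs : U ⊆ (chartAt Plane x₀).source) :
    ContMDiffOn (𝓡 2) (𝓡 2).tangent ∞ (fun x => (⟨x, X x⟩ : TangentBundle (𝓡 2) S)) U ↔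
      ContMDiffOn (𝓡 2) 𝓘(ℝ, Plane) ∞ (fun x => chartVec x₀ x (X x)) U := by
  have h := (trivializationAt Plane (TangentSpace (𝓡 2)) x₀).contMDiffOn_section_iff
    (IB := 𝓡 2) (n := ∞) (s := X) (a := U) hU (by simpa using hs)
  refine h.trans (contMDiffOn_congr fun x hx => ?_)
  have h1 := TangentBundle.continuousLinearMapAt_trivializationAt (I := 𝓡 2) (hs hx)
  have h2 := (hasMFDerivAt_extChartAt (I := 𝓡 2) (hs hx)).mfderiv
  rw [h2] at h1
  rw [chartVec, ← h1]
  exact (congrFun ((trivializationAt Plane (TangentSpace (𝓡 2)) x₀).coe_linearMapAt_of_mem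
    (R := ℝ) (by simpa using hs hx)) (X x)).symm

end Chart

end Manifold

/-! ### Adapted fields in charts, the angle and congruence. -/

lemma IsFramedSurface.congr_frame {W : Set Plane} {f : Plane → E} {X Y : Plane → Plane}
    {ξ ξ' : Plane → E} (h : IsFramedSurface W f X Y ξ) (hξ : ∀ u ∈ W, ξ' u = ξ u) :
    IsFramedSurface W f X Y ξ' :=
  ⟨h.isOpen, h.mem, h.smooth, h.smoothX, h.smoothY, h.smoothξ.congr hξ,
    fun u hu => by rw [hξ u hu, h.fderiv_X u hu], fun u hu => by rw [hξ u hu, h.fderiv_Y u hu],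
    fun u hu => by rw [hξ u hu]; exact h.frame u hu⟩

open IsFramedSurface

lemma nrm_smul (ε : ℝ) (ξ : E) : nrm (ε • ξ) = (ε * ε) • nrm ξ := by
  simp only [nrm, Prod.smul_fst, Prod.smul_snd, smul_mul_smul_comm, smul_sub]

/-- The coefficients do not change when the field changes sign. -/
lemma coeff_eq_of_eventuallyEq {ξ ξ' : Plane → E} {X X' : Plane → Plane} {u : Plane} {ε : ℝ}
    (hε : ε * ε = 1) (hξ : ξ' =ᶠ[𝓝 u] fun x => ε • ξ x) (hX : X' u = ε • X u)
    (hd : DifferentiableAt ℝ ξ u) :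
    coeffA ξ' X' u = coeffA ξ X u ∧ coeffB ξ' X' u = coeffB ξ X u := by
  have h1 : fderiv ℝ ξ' u (X' u) = fderiv ℝ ξ u (X u) := by
    have e : fderiv ℝ (fun x => ε • ξ x) u = ε • fderiv ℝ ξ u := fderiv_fun_const_smul hd ε
    rw [hξ.fderiv_eq, e, hX, smul_apply, map_smul, smul_smul, hε, one_smul]
  have h2 : nrm (ξ' u) = nrm (ξ u) := by rw [hξ.self_of_nhds, nrm_smul, hε, one_smul]
  exact ⟨by rw [coeffA, coeffA, h1, h2], by rw [coeffB, coeffB, h1, h2]⟩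

lemma IsFramedSurface.eventually_coeff_eq {W : Set Plane} {f : Plane → E} {X Y : Plane → Plane}
    {ξ : Plane → E} (h : IsFramedSurface W f X Y ξ) {u : Plane} (hu : u ∈ W) :
    ∀ᶠ x in 𝓝 u, coeffA ξ X x = coeffA ξ X u ∧ coeffB ξ X x = coeffB ξ X u := by
  obtain ⟨ε, hε, hb⟩ := Metric.isOpen_iff.1 h.isOpen u hu
  have hc : IsPreconnected (Metric.ball u ε) := (convex_ball u ε).isPreconnected
  filter_upwards [Metric.ball_mem_nhds u hε] with x hx
  have hu' := Metric.mem_ball_self (x := u) hε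
  exact ⟨Metric.isOpen_ball.is_const_of_fderiv_eq_zero hc
      ((h.contDiffOn_coeffA.mono hb).differentiableOn (by simp))
      (fun y hy => (h.fderiv_coeff_eq_zero (hb hy)).1) hx hu',
    Metric.isOpen_ball.is_const_of_fderiv_eq_zero hc
      ((h.contDiffOn_coeffB.mono hb).differentiableOn (by simp))
      (fun y hy => (h.fderiv_coeff_eq_zero (hb hy)).2) hx hu'⟩

section Manifold

variable {S : Type*} [TopologicalSpace S] [ChartedSpace (EuclideanSpace ℝ (Fin 2)) S]

/-- The left trivialisation of `dF(X)`. -/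
def fieldFrame (F : S → E) (X : (x : S) → TangentSpace (𝓡 2) x) (y : S) : E := triv F y (X y)

lemma dE_linearMap_comp (L : E →ₗ[ℝ] E) {Z : S → E} {x : S}
    (hZ : MDifferentiableAt (𝓡 2) 𝓘(ℝ, E) Z x) (v : TangentSpace (𝓡 2) x) :
    MDifferentiableAt (𝓡 2) 𝓘(ℝ, E) (fun y => L (Z y)) x ∧
      dE (fun y => L (Z y)) x v = L (dE Z x v) := by
  have hL : MDifferentiableAt 𝓘(ℝ, E) 𝓘(ℝ, E) L.toContinuousLinearMap (Z x) :=
    L.toContinuousLinearMap.differentiableAt.mdifferentiableAt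
  refine ⟨hL.comp x hZ, ?_⟩
  have h := mfderiv_comp x hL hZ
  rw [mfderiv_eq_fderiv, ContinuousLinearMap.fderiv] at h
  exact congrArg (fun l => l v) h

lemma chart_mem {U : Set S} {x₀ y : S} (hy : y ∈ U) (hy' : y ∈ (chartAt Plane x₀).source) :
    chartAt Plane x₀ y ∈ (chartAt Plane x₀).target ∩ (chartAt Plane x₀).symm ⁻¹' U :=
  ⟨(chartAt Plane x₀).map_source hy', by
    rw [Set.mem_preimage, (chartAt Plane x₀).left_inv hy']; exact hy⟩

variable [IsManifold (𝓡 2) ∞ S] {F : S → E} {U : Set S} {X : (x : S) → TangentSpace (𝓡 2) x}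

/-- The bridge from the manifold to the coordinate computations: the structure equations apply to
every adapted field in every chart. -/
lemma exists_isFramedSurface_chart (hF : IsDegenerateAlmostComplex F) (hX : IsAdaptedField F U X)
    (x₀ : S) : ∃ Y, IsFramedSurface
      ((chartAt Plane x₀).target ∩ (chartAt Plane x₀).symm ⁻¹' U)
      (F ∘ (chartAt Plane x₀).symm) (chartField x₀ X) Y
      (fieldFrame F X ∘ (chartAt Plane x₀).symm) := by
  set W := (chartAt Plane x₀).target ∩ (chartAt Plane x₀).symm ⁻¹' U
  have hW : IsOpen W := (chartAt Plane x₀).isOpen_inter_preimage_symm hX.isOpen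
  have hS := (hF.isComplexSurface x₀).mono hW Set.inter_subset_left
  have hs : ContDiffOn ℝ ∞ (chartField x₀ X) W := by
    have h1 := (contMDiffOn_field_iff (x₀ := x₀)
      (hX.isOpen.inter (chartAt Plane x₀).open_source) Set.inter_subset_right).1
      (hX.smooth.mono Set.inter_subset_left)
    have h2 := (contMDiffOn_chart_symm (I := 𝓡 2) (x := x₀) (n := ∞)).mono
      (Set.inter_subset_left (s := (chartAt Plane x₀).target)
        (t := (chartAt Plane x₀).symm ⁻¹' U))
    exact contMDiffOn_iff_contDiffOn.1
      (h1.comp h2 fun u hu => ⟨hu.2, (chartAt Plane x₀).map_target hu.1⟩)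
  have hfr : ∀ u ∈ W, (fieldFrame F X ∘ (chartAt Plane x₀).symm) u =
      leftTriv ((F ∘ (chartAt Plane x₀).symm) u)
        (fderiv ℝ (F ∘ (chartAt Plane x₀).symm) u (chartField x₀ X u)) := by
    intro u hu
    obtain ⟨y, hy, rfl⟩ : ∃ y ∈ (chartAt Plane x₀).source, chartAt Plane x₀ y = u :=
      ⟨_, (chartAt Plane x₀).map_target hu.1, (chartAt Plane x₀).right_inv hu.1⟩
    rw [chartField_apply hy, hF.leftTriv_chart hy, comp_chart_apply _ hy, fieldFrame]
  obtain ⟨Y, hY⟩ := hS.exists_isFramedSurface hs fun u hu => by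
    rw [← hfr u hu]
    exact hF.isFrame (hX.normalized _ hu.2)
  exact ⟨Y, hY.congr_frame hfr⟩

lemma mdifferentiableAt_fieldFrame (hF : IsDegenerateAlmostComplex F)
    (hX : IsAdaptedField F U X) {x : S} (hx : x ∈ U) :
    MDifferentiableAt (𝓡 2) 𝓘(ℝ, E) (fieldFrame F X) x := by
  obtain ⟨Y, hY⟩ := exists_isFramedSurface_chart hF hX x
  have hx' := mem_chart_source Plane x
  have h1 := (hY.hasFDerivAt_frame (chart_mem hx hx')).differentiableAt.mdifferentiableAt
  have h2 := (mdifferentiable_chart (I := 𝓡 2) x).mdifferentiableAt hx'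
  refine (MDifferentiableAt.comp (I' := 𝓡 2) x h1 h2).congr_of_eventuallyEq ?_
  filter_upwards [(chartAt Plane x).open_source.mem_nhds hx'] with z hz
  simp [(chartAt Plane x).left_inv hz]

/-- The two functions in the definition of the angle, in a chart. -/
lemma angle_eq (hF : IsDegenerateAlmostComplex F) (hX : IsAdaptedField F U X) {x₀ x : S}
    (hx : x ∈ U) (hx' : x ∈ (chartAt Plane x₀).source) :
    g (F x) (nablaXX F X x) (nablaJPX F X x) =
      -(1 / √3) * (coeffA (fieldFrame F X ∘ (chartAt Plane x₀).symm) (chartField x₀ X)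
        (chartAt Plane x₀ x) + coeffB (fieldFrame F X ∘ (chartAt Plane x₀).symm)
          (chartField x₀ X) (chartAt Plane x₀ x)) ∧
    g (F x) (nablaXX F X x) (J (F x) (nablaJPX F X x)) =
      coeffA (fieldFrame F X ∘ (chartAt Plane x₀).symm) (chartField x₀ X) (chartAt Plane x₀ x) -
        coeffB (fieldFrame F X ∘ (chartAt Plane x₀).symm) (chartField x₀ X)
          (chartAt Plane x₀ x) - 2 / 3 := by
  obtain ⟨Y, hY⟩ := exists_isFramedSurface_chart hF hX x₀
  have hm := hF.mem x
  have hd := mdifferentiableAt_fieldFrame hF hX hx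
  have e0 := hY.fderiv_frame_X (chart_mem hx hx')
  rw [chartField_apply hx', ← dE_eq_fderiv hx' hd, comp_chart_apply _ hx'] at e0
  set ξ := fieldFrame F X x with hξ
  set η := dE (fieldFrame F X) x (X x) with hη
  have e1 : nablaXX F X x = F x * (η + Γ ξ ξ) := rfl
  have hJP : ∀ y, leftTriv (F y) (J (F y) (P (F y) (dE F y (X y)))) =
      jAlg (pAlg (fieldFrame F X y)) := by
    intro y
    rw [hF.dE_eq, P_mul (hF.mem y), J_mul (hF.mem y), leftTriv_mul (hF.mem y), fieldFrame]
  have hPP : ∀ y, leftTriv (F y) (P (F y) (dE F y (X y))) = pAlg (fieldFrame F X y) := by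
    intro y
    rw [hF.dE_eq, P_mul (hF.mem y), leftTriv_mul (hF.mem y), fieldFrame]
  -- In the left trivialisation `J` and `P` are constant linear maps, so the derivative terms of
  -- `(∇_X J)PX` cancel and only `Γ` contributes.
  obtain ⟨d1, d2⟩ := dE_linearMap_comp pAlg hd (X x)
  obtain ⟨-, d3⟩ := dE_linearMap_comp jAlg d1 (X x)
  have e2 : nablaJPX F X x = F x * (Γ ξ (jAlg (pAlg ξ)) - jAlg (Γ ξ (pAlg ξ))) := by
    simp only [nablaJPX, nablaJ, nabla, hJP, hPP, leftMul_apply]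
    rw [J_mul hm, d3, map_add, ← mul_sub]
    change F x * (jAlg (dE (fun y => pAlg (fieldFrame F X y)) x (X x)) + Γ ξ (jAlg (pAlg ξ)) -
      (jAlg (dE (fun y => pAlg (fieldFrame F X y)) x (X x)) + jAlg (Γ ξ (pAlg ξ)))) = _
    congr 1
    abel
  have hfr : IsFrame ξ := hF.isFrame (hX.normalized x hx)
  rw [e1, e2, J_mul hm, g_mul hm, g_mul hm, e0]
  exact hfr.angle _ _

/-- Near a point, the fields differ by a constant sign. -/
lemma coeff_independent (hF : IsDegenerateAlmostComplex F) (hX : IsAdaptedField F U X)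
    {U' : Set S} {X' : (x : S) → TangentSpace (𝓡 2) x} (hX' : IsAdaptedField F U' X') {x : S}
    (hx : x ∈ U) (hx' : x ∈ U') :
    coeffA (fieldFrame F X' ∘ (chartAt Plane x).symm) (chartField x X') (chartAt Plane x x) =
      coeffA (fieldFrame F X ∘ (chartAt Plane x).symm) (chartField x X) (chartAt Plane x x) ∧
    coeffB (fieldFrame F X' ∘ (chartAt Plane x).symm) (chartField x X') (chartAt Plane x x) =
      coeffB (fieldFrame F X ∘ (chartAt Plane x).symm) (chartField x X) (chartAt Plane x x) := by
  obtain ⟨Y, hY⟩ := exists_isFramedSurface_chart hF hX x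
  obtain ⟨Y', hY'⟩ := exists_isFramedSurface_chart hF hX' x
  set e := chartAt Plane x
  have hs := mem_chart_source Plane x
  have hu := chart_mem hx hs
  have hu' := chart_mem hx' hs
  set W := e.target ∩ e.symm ⁻¹' U
  set W' := e.target ∩ e.symm ⁻¹' U'
  have hWW : W ∩ W' ∈ 𝓝 (e x) := (hY.isOpen.inter hY'.isOpen).mem_nhds ⟨hu, hu'⟩
  set ξ := fieldFrame F X ∘ e.symm with hξ
  set ξ' := fieldFrame F X' ∘ e.symm with hξ'
  -- The relative sign of the two fields is the value of the continuous function `gAlg (ξ' u) (pAlg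
  -- (ξ u))`, hence is constant near the point.
  have hsign : ∀ u ∈ W ∩ W', ∃ ε : ℝ, ε * ε = 1 ∧ X' (e.symm u) = ε • X (e.symm u) ∧
      gAlg (ξ' u) (pAlg (ξ u)) = ε := by
    intro u hu
    have n1 := hX.normalized _ hu.1.2
    have n2 := hX'.normalized _ hu.2.2
    have n3 : gAlg (ξ u) (pAlg (ξ u)) = 1 :=
      (pForm_eq_one_iff.1 ((hF.isNormalized_iff _).1 n1)).1
    obtain ⟨ε, hε, he⟩ : ∃ ε : ℝ, ε * ε = 1 ∧ X' (e.symm u) = ε • X (e.symm u) := by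
      rcases hF.eq_or_eq_neg n1 n2 with h | h
      · exact ⟨1, by norm_num, by rw [h, one_smul]⟩
      · exact ⟨-1, by norm_num, by rw [h, neg_one_smul]⟩
    refine ⟨ε, hε, he, ?_⟩
    have : ξ' u = ε • ξ u := by
      rw [hξ', hξ, Function.comp_apply, Function.comp_apply, fieldFrame, fieldFrame, he, triv_smul]
    rw [this, gAlg_smul_left, n3, mul_one]
  obtain ⟨ε₀, hε₀, he₀, hs₀⟩ := hsign (e x) ⟨hu, hu'⟩
  have hcont : ContinuousAt (fun u => gAlg (ξ' u) (pAlg (ξ u))) (e x) :=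
    (contDiffOn_gAlg (hY'.smoothξ.mono Set.inter_subset_right)
      (pAlg.toContinuousLinearMap.contDiff.comp_contDiffOn
        (hY.smoothξ.mono Set.inter_subset_left))).continuousOn.continuousAt hWW
  have hnear : ∀ᶠ u in 𝓝 (e x), |gAlg (ξ' u) (pAlg (ξ u)) - ε₀| < 1 := by
    have := Metric.continuousAt_iff'.1 hcont 1 one_pos
    rw [hs₀] at this
    exact this
  have key : ∀ᶠ u in 𝓝 (e x), X' (e.symm u) = ε₀ • X (e.symm u) := by
    filter_upwards [hWW, hnear] with u hu hu2
    obtain ⟨ε, hε, he, hs⟩ := hsign u hu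
    rw [hs] at hu2
    rcases mul_self_eq_one_iff.1 hε with rfl | rfl <;>
      rcases mul_self_eq_one_iff.1 hε₀ with rfl | rfl
    · exact he
    · norm_num at hu2
    · norm_num at hu2
    · exact he
  refine coeff_eq_of_eventuallyEq hε₀ ?_ ?_ (hY.hasFDerivAt_frame hu).differentiableAt
  · filter_upwards [key] with u hu
    rw [hξ', hξ, Function.comp_apply, Function.comp_apply, fieldFrame, fieldFrame, hu, triv_smul]
  · rw [chartField, chartField, key.self_of_nhds, map_smul]

/-- A nonzero vector at `x` is extended as a constant field in the chart, normalized there by a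
complex factor, and pulled back. -/
lemma exists_isAdaptedField (hF : IsDegenerateAlmostComplex F) (hP : PNotPreserving F) (x : S) :
    ∃ (U : Set S) (X : (y : S) → TangentSpace (𝓡 2) y), x ∈ U ∧ IsAdaptedField F U X := by
  obtain ⟨v, hv⟩ : ∃ v : TangentSpace (𝓡 2) x, v ≠ 0 := exists_ne (0 : Plane)
  have hs := mem_chart_source Plane x
  have h0 := hF.pForm_ne_zero hP hv
  rw [← hF.leftTriv_chart hs] at h0
  obtain ⟨W', Xc, hW', hsub, hmem, hXc, hn⟩ :=
    (hF.isComplexSurface x).exists_normalized (mem_chart_target Plane x) h0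
  have hex : ∀ y : S, ∃ w : TangentSpace (𝓡 2) y, y ∈ (chartAt Plane x).source →
      chartVec x y w = Xc (chartAt Plane x y) := by
    intro y
    by_cases hy : y ∈ (chartAt Plane x).source
    · obtain ⟨w, hw⟩ := (chartVec_bijective hy).2 (Xc (chartAt Plane x y))
      exact ⟨w, fun _ => hw⟩
    · exact ⟨0, fun h => absurd h hy⟩
  choose X hX using hex
  have hU : IsOpen ((chartAt Plane x).source ∩ chartAt Plane x ⁻¹' W') :=
    (chartAt Plane x).isOpen_inter_preimage hW'
  refine ⟨(chartAt Plane x).source ∩ chartAt Plane x ⁻¹' W', X, ⟨hs, hmem⟩, hU, ?_, ?_⟩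
  · rw [contMDiffOn_field_iff hU Set.inter_subset_left]
    have h1 := (contMDiffOn_chart (I := 𝓡 2) (x := x) (n := ∞)).mono
      (Set.inter_subset_left (s := (chartAt Plane x).source) (t := chartAt Plane x ⁻¹' W'))
    refine ((contMDiffOn_iff_contDiffOn.2 hXc).comp h1 fun y hy => hy.2).congr fun y hy => ?_
    exact hX y hy.1
  · intro y hy
    rw [hF.isNormalized_iff, ← hF.leftTriv_chart hy.1, hX y hy.1]
    exact hn _ hy.2

/-- The angle is constant. -/
lemma exists_isAngle [ConnectedSpace S] (hF : IsDegenerateAlmostComplex F)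
    (hP : PNotPreserving F) : ∃ φ : ℝ, IsAngle F φ := by
  have hex := fun x : S => exists_isAdaptedField hF hP x
  choose V Z hxV hZ using hex
  -- The pair of angle functions, computed at each point with the field chosen for that point;
  -- `hind` shows that any other adapted field gives the same pair.
  set N : S → ℝ × ℝ := fun x => (g (F x) (nablaXX F (Z x) x) (nablaJPX F (Z x) x),
    g (F x) (nablaXX F (Z x) x) (J (F x) (nablaJPX F (Z x) x))) with hN
  have hind : ∀ (U : Set S) (X : (x : S) → TangentSpace (𝓡 2) x), IsAdaptedField F U X →
      ∀ x ∈ U, (g (F x) (nablaXX F X x) (nablaJPX F X x),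
        g (F x) (nablaXX F X x) (J (F x) (nablaJPX F X x))) = N x := by
    intro U X hX x hx
    obtain ⟨c1, c2⟩ := coeff_independent hF (hZ x) hX (hxV x) hx
    obtain ⟨a1, a2⟩ := angle_eq hF hX hx (mem_chart_source Plane x)
    obtain ⟨b1, b2⟩ := angle_eq hF (hZ x) (hxV x) (mem_chart_source Plane x)
    rw [hN]
    simp only
    rw [a1, a2, b1, b2, c1, c2]
  have hloc : IsLocallyConstant N := by
    refine (IsLocallyConstant.iff_eventually_eq N).2 fun x => ?_
    obtain ⟨Y, hY⟩ := exists_isFramedSurface_chart hF (hZ x) x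
    have hs := mem_chart_source Plane x
    have hc := ((chartAt Plane x).continuousAt hs).eventually
      (hY.eventually_coeff_eq (chart_mem (hxV x) hs))
    filter_upwards [hc, (chartAt Plane x).open_source.mem_nhds hs,
      (hZ x).isOpen.mem_nhds (hxV x)] with y hy hys hyV
    obtain ⟨a1, a2⟩ := angle_eq hF (hZ x) hyV hys
    rw [← hind _ _ (hZ x) y hyV, ← hind _ _ (hZ x) x (hxV x)]
    obtain ⟨b1, b2⟩ := angle_eq hF (hZ x) (hxV x) hs
    rw [a1, a2, b1, b2, hy.1, hy.2]
  obtain ⟨x₀⟩ : Nonempty S := inferInstance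
  obtain ⟨φ, hφ⟩ : ∃ φ : ℝ, 2 / 3 * Real.cos φ = (N x₀).1 ∧ 2 / 3 * Real.sin φ = (N x₀).2 := by
    obtain ⟨b1, b2⟩ := angle_eq hF (hZ x₀) (hxV x₀) (mem_chart_source Plane x₀)
    obtain ⟨Y, hY⟩ := exists_isFramedSurface_chart hF (hZ x₀) x₀
    have hq := (hY.compatibility (chart_mem (hxV x₀) (mem_chart_source Plane x₀))).1
    -- The conic becomes a circle: `(a + b)²/3 + (a - b - 2/3)² = 4/3 (a² - ab + b² - a + b) + 4/9`.
    have hn : (N x₀).1 ^ 2 + (N x₀).2 ^ 2 = 4 / 9 := by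
      rw [hN]
      simp only
      rw [b1, b2]
      linear_combination (coeffA _ _ _ + coeffB _ _ _) ^ 2 * inv_sqrt_three_mul_self +
        (4 / 3) * hq
    have h1 : ‖(⟨3 / 2 * (N x₀).1, 3 / 2 * (N x₀).2⟩ : ℂ)‖ = 1 := by
      rw [Complex.norm_def, Complex.normSq_mk, Real.sqrt_eq_one]
      linear_combination (9 / 4) * hn
    obtain ⟨θ, hθ⟩ := (Complex.norm_eq_one_iff _).1 h1
    refine ⟨θ, ?_, ?_⟩
    · have := congrArg Complex.re hθ
      rw [Complex.exp_ofReal_mul_I_re] at this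
      rw [this]; ring
    · have := congrArg Complex.im hθ
      rw [Complex.exp_ofReal_mul_I_im] at this
      rw [this]; ring
  refine ⟨φ, fun U X hX x hx => ?_⟩
  have h := hind U X hX x hx
  rw [hloc.apply_eq_of_preconnectedSpace x x₀] at h
  rw [hφ.1, hφ.2, ← h]
  exact ⟨rfl, rfl⟩

/-- The angle prescribes `a + b` and `a - b`, hence both coefficients; surfaces with the same angle
satisfy the same frame equations. -/
lemma coeff_eq_of_isAngle (hF : IsDegenerateAlmostComplex F) {φ : ℝ} (hφ : IsAngle F φ)
    (hX : IsAdaptedField F U X) (x₀ : S) :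
    ∀ u ∈ (chartAt Plane x₀).target ∩ (chartAt Plane x₀).symm ⁻¹' U,
      coeffA (fieldFrame F X ∘ (chartAt Plane x₀).symm) (chartField x₀ X) u =
        1 / 3 * (1 + Real.sin φ - √3 * Real.cos φ) ∧
      coeffB (fieldFrame F X ∘ (chartAt Plane x₀).symm) (chartField x₀ X) u =
        -(1 / 3) * (1 + Real.sin φ + √3 * Real.cos φ) := by
  intro u hu
  obtain ⟨y, hy, rfl⟩ : ∃ y ∈ (chartAt Plane x₀).source, chartAt Plane x₀ y = u :=
    ⟨_, (chartAt Plane x₀).map_target hu.1, (chartAt Plane x₀).right_inv hu.1⟩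
  have hyU : y ∈ U := by
    have := hu.2
    rwa [Set.mem_preimage, (chartAt Plane x₀).left_inv hy] at this
  obtain ⟨a1, a2⟩ := angle_eq hF hX hyU hy
  obtain ⟨b1, b2⟩ := hφ U X hX y hyU
  rw [a1] at b1
  rw [a2] at b2
  have hs : √3 * (1 / √3) = 1 := by
    rw [mul_one_div, div_self (by positivity)]
  generalize (1 / √3 : ℝ) = s at *
  generalize coeffA _ _ _ = a at *
  generalize coeffB _ _ _ = b at *
  have h1 : a + b = -(√3 * (2 / 3 * Real.cos φ)) := by
    linear_combination √3 * b1 - (a + b) * hs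
  constructor
  · linear_combination (1 / 2) * h1 - (1 / 2) * b2
  · linear_combination (1 / 2) * h1 + (1 / 2) * b2

/-- Surfaces with the same angle are locally congruent. -/
lemma exists_congruence {G : S → E} (hF : IsDegenerateAlmostComplex F) (hPF : PNotPreserving F)
    (hG : IsDegenerateAlmostComplex G) (hPG : PNotPreserving G) {φ : ℝ} (hφF : IsAngle F φ)
    (hφG : IsAngle G φ) (x y : S) : ∃ (Φ : E → E) (σ : OpenPartialHomeomorph S S),
      IsIsometry Φ ∧ x ∈ σ.source ∧ σ x = y ∧
      ContMDiffOn (𝓡 2) (𝓡 2) ∞ σ σ.source ∧ ContMDiffOn (𝓡 2) (𝓡 2) ∞ σ.symm σ.target ∧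
      ∀ z ∈ σ.source, Φ (F z) = G (σ z) := by
  obtain ⟨U₁, X₁, hx, hX₁⟩ := exists_isAdaptedField hF hPF x
  obtain ⟨U₂, X₂, hy, hX₂⟩ := exists_isAdaptedField hG hPG y
  obtain ⟨Y₁, h₁⟩ := exists_isFramedSurface_chart hF hX₁ x
  obtain ⟨Y₂, h₂⟩ := exists_isFramedSurface_chart hG hX₂ y
  have c₁ := coeff_eq_of_isAngle hF hφF hX₁ x
  have c₂ := coeff_eq_of_isAngle hG hφG hX₂ y
  have hu₁ := chart_mem hx (mem_chart_source Plane x)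
  have hu₂ := chart_mem hy (mem_chart_source Plane y)
  have hfr₁ : IsFrame (fieldFrame F X₁ x) := hF.isFrame (hX₁.normalized x hx)
  have hfr₂ : IsFrame (fieldFrame G X₂ y) := hG.isFrame (hX₂.normalized y hy)
  obtain ⟨C, D, hCD, hDC, hconj⟩ := hfr₁.exists_conj hfr₂
  obtain ⟨K, hiso, hK, hmul⟩ := exists_isometry (hF.mem x) (hG.mem y) hCD hDC
  set e₁ := chartAt Plane x
  set e₂ := chartAt Plane y
  have hx' : x ∈ e₁.source := mem_chart_source Plane x
  have hy' : y ∈ e₂.source := mem_chart_source Plane y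
  have d₁ := fun u hu => h₁.frameDist_eq (fun u hu => (c₁ u hu).1) (fun u hu => (c₁ u hu).2)
    (mulMul K (D, D)) C D hDC hmul (u := u) hu
  -- The second surface is left unmoved: the identity map with trivial conjugation puts it in the
  -- same form as the first.
  have d₂ := fun u hu => h₂.frameDist_eq (fun u hu => (c₂ u hu).1) (fun u hu => (c₂ u hu).2)
    (ContinuousLinearMap.id ℝ E) 1 1 (mul_one 1)
    (fun x z => by
      change x * z = x * (1 * z * 1)
      rw [one_mul, mul_one]) (u := u) hu
  have s₁ : ContDiffOn ℝ ∞ (fun u => (mulMul K (D, D) ((F ∘ e₁.symm) u),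
      mulMul (C, C) (D, D) ((fieldFrame F X₁ ∘ e₁.symm) u))) (e₁.target ∩ e₁.symm ⁻¹' U₁) :=
    ((mulMul K (D, D)).contDiff.comp_contDiffOn h₁.smooth).prodMk
      ((mulMul (C, C) (D, D)).contDiff.comp_contDiffOn h₁.smoothξ)
  have s₂ : ContDiffOn ℝ ∞ (fun u => (ContinuousLinearMap.id ℝ E ((G ∘ e₂.symm) u),
      mulMul (1, 1) (1, 1) ((fieldFrame G X₂ ∘ e₂.symm) u))) (e₂.target ∩ e₂.symm ⁻¹' U₂) :=
    h₂.smooth.prodMk ((mulMul (1, 1) (1, 1)).contDiff.comp_contDiffOn h₂.smoothξ)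
  have hone : ∀ z : E, mulMul (1, 1) (1, 1) z = z := fun z => by
    rw [mulMul_apply]
    change 1 * z * 1 = z
    rw [one_mul, mul_one]
  -- The isometry matches the points and the conjugation matches the frames, so both integral
  -- surfaces start at the same point of `E × E`.
  have h12 : (mulMul K (D, D) ((F ∘ e₁.symm) (e₁ x)),
      mulMul (C, C) (D, D) ((fieldFrame F X₁ ∘ e₁.symm) (e₁ x))) =
      (ContinuousLinearMap.id ℝ E ((G ∘ e₂.symm) (e₂ y)),
        mulMul (1, 1) (1, 1) ((fieldFrame G X₂ ∘ e₂.symm) (e₂ y))) := by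
    rw [comp_chart_apply _ hx', comp_chart_apply _ hx', comp_chart_apply _ hy',
      comp_chart_apply _ hy', hK, mulMul_apply (C, C), hconj, hone]
    rfl
  have hinj : Function.Injective (frameDist (1 / 3 * (1 + Real.sin φ - √3 * Real.cos φ))
      (-(1 / 3) * (1 + Real.sin φ + √3 * Real.cos φ))
      (mulMul K (D, D) ((F ∘ e₁.symm) (e₁ x)),
      mulMul (C, C) (D, D) ((fieldFrame F X₁ ∘ e₁.symm) (e₁ x)))) := by
    refine frameDist_injective _ _ ?_ ?_
    · rw [comp_chart_apply _ hx', hK]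
      exact hG.mem y
    · change IsFrame (mulMul (C, C) (D, D) ((fieldFrame F X₁ ∘ e₁.symm) (e₁ x)))
      rw [comp_chart_apply _ hx', mulMul_apply, hconj]
      exact hfr₂
  obtain ⟨τ, t1, t2, t3, t4, t5, t6, t7⟩ := exists_openPartialHomeomorph_of_integral h₁.isOpen
    h₂.isOpen s₁ s₂ (contDiff_frameDist _ _) d₁ d₂ hu₁ hu₂ h12 hinj
  have hsrc : ∀ z ∈ ((e₁ ≫ₕ τ) ≫ₕ e₂.symm).source, z ∈ e₁.source ∧ e₁ z ∈ τ.source ∧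
      τ (e₁ z) ∈ e₂.target := fun z hz => ⟨hz.1.1, hz.1.2, hz.2⟩
  have htgt : ∀ z ∈ ((e₁ ≫ₕ τ) ≫ₕ e₂.symm).target, z ∈ e₂.source ∧ e₂ z ∈ τ.target ∧
      τ.symm (e₂ z) ∈ e₁.target := fun z hz => ⟨hz.1, hz.2.1, hz.2.2⟩
  refine ⟨mulMul K (D, D), (e₁ ≫ₕ τ) ≫ₕ e₂.symm, hiso, ⟨⟨hx', t1⟩, ?_⟩, ?_, ?_, ?_, ?_⟩
  · change τ (e₁ x) ∈ e₂.target
    rw [t2]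
    exact e₂.map_source hy'
  · change e₂.symm (τ (e₁ x)) = y
    rw [t2, e₂.left_inv hy']
  · have m1 := (contMDiffOn_chart (I := 𝓡 2) (x := x) (n := ∞)).mono
      (fun z hz => (hsrc z hz).1)
    have m2 := (contMDiffOn_iff_contDiffOn.2 t5).comp m1 fun z hz => (hsrc z hz).2.1
    exact (contMDiffOn_chart_symm (I := 𝓡 2) (x := y) (n := ∞)).comp m2
      fun z hz => (hsrc z hz).2.2
  · have m1 := (contMDiffOn_chart (I := 𝓡 2) (x := y) (n := ∞)).mono
      (fun z hz => (htgt z hz).1)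
    have m2 := (contMDiffOn_iff_contDiffOn.2 t6).comp m1 fun z hz => (htgt z hz).2.1
    exact (contMDiffOn_chart_symm (I := 𝓡 2) (x := x) (n := ∞)).comp m2
      fun z hz => (htgt z hz).2.2
  · intro z hz
    have h := congrArg Prod.fst (t7 (e₁ z) (hsrc z hz).2.1)
    rw [comp_chart_apply F (hsrc z hz).1] at h
    exact h

end Manifold

end NKSL2

end

theorem theorem2 {S : Type*} [TopologicalSpace S] [ChartedSpace (EuclideanSpace ℝ (Fin 2)) S]
    [IsManifold (𝓡 2) ∞ S] [ConnectedSpace S] :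
    -- existence of a local field `X`, and its uniqueness up to sign
    (∀ F : S → NKSL2.E, NKSL2.IsDegenerateAlmostComplex F → NKSL2.PNotPreserving F → ∀ x : S,
      (∃ (U : Set S) (X : (y : S) → TangentSpace (𝓡 2) y), x ∈ U ∧ NKSL2.IsAdaptedField F U X) ∧
      ∀ v w : TangentSpace (𝓡 2) x, NKSL2.IsNormalized F x v → NKSL2.IsNormalized F x w →
        w = v ∨ w = -v) ∧
    -- (i)
    (∀ F : S → NKSL2.E, NKSL2.IsDegenerateAlmostComplex F → NKSL2.PNotPreserving F →
      ∃ φ : ℝ, NKSL2.IsAngle F φ) ∧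
    -- (ii)
    (∀ F G : S → NKSL2.E, NKSL2.IsDegenerateAlmostComplex F → NKSL2.PNotPreserving F →
      NKSL2.IsDegenerateAlmostComplex G → NKSL2.PNotPreserving G →
      ∀ φ : ℝ, NKSL2.IsAngle F φ → NKSL2.IsAngle G φ →
      ∀ x y : S, ∃ (Φ : NKSL2.E → NKSL2.E) (σ : OpenPartialHomeomorph S S),
        NKSL2.IsIsometry Φ ∧ x ∈ σ.source ∧ σ x = y ∧
        ContMDiffOn (𝓡 2) (𝓡 2) ∞ σ σ.source ∧ ContMDiffOn (𝓡 2) (𝓡 2) ∞ σ.symm σ.target ∧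
        ∀ z ∈ σ.source, Φ (F z) = G (σ z)) := by
  refine ⟨fun F hF hP x => ⟨NKSL2.exists_isAdaptedField hF hP x,
      fun v w hv hw => hF.eq_or_eq_neg hv hw⟩,
    fun F hF hP => NKSL2.exists_isAngle hF hP,
    fun F G hF hPF hG hPG φ h1 h2 x y => NKSL2.exists_congruence hF hPF hG hPG h1 h2 x y⟩
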